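/- Let $T$ be a finite tree with at least two vertices, with graph Laplacian $L(T)$, and let $a(T)$ be the smallest nonzero eigenvalue of $L(T)$. Let $v_1,\ldots,v_k$ ($k\ge 1$) be the successive, distinct vertices of a path in $T$. For $1\le i\le k$ let $T_i$ be the maximal subtree of $T$ with $V(T_i)\cap\{v_1,\ldots,v_k\}=\{v_i\}$ that contains $v_i$, and let $T_{i,1},\ldots,T_{i,\deg_{T_i}(v_i)}$ be the branches of $T_i$ at $v_i$, i.e. the subtrees spanned by $v_i$ and one connected component of $T_i-v_i$. For a graph $H$ and vertices $u,u'$, let $L_u(H)$ and $L_{u,u'}(H)$ be the matrices obtained from $L(H)$ by deleting the rows and columns of $u$, respectively of $u$ and $u'$; $\lambda_{\min}$ denotes the smallest eigenvalue. A pendant vertex of $T_i$ is here a vertex $v\ne v_i$ with $\deg_{T_i}(v)=1$. For a pendant vertex $v$ of a tree and a vertex $u\ne v$, let $\hat T$ be the branch at $u$ that contains $v$. If $v$ and $u$ are not adjacent, put, with $e$ and $e'$ the unit vectors at the neighbour of $v$ and at the neighbour of $u$ in $\hat T$, $$g_{v,u}(\lambda)=\frac{1-\lambda-e^\top(L_{v,u}(\hat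 T)-\lambda)^{-1}e}{e'^\top(L_{v,u}(\hat T)-\lambda)^{-1}e},$$ and put $g_{v,u}(\lambda)=1-\lambda$ if $v$ and $u$ are adjacent. A Fiedler vector is an eigenvector of $L(T)$ for $a(T)$. The tree $T$ has the property (FED) if $a(T)$ is simple, and the Fiedler vector attains its maximum and its minimum at exactly one vertex each, and these two vertices are the endpoints of a longest path of $T$. (a) If $a(T)<\lambda_{\min}(L_{v_i}(T_{i,j}))$ for all $i=1,\ldots,k$ and $j=1,\ldots,\deg_{T_i}(v_i)$, then $a(T)$ is a simple eigenvalue of $L(T)$. (b) Under the assumption of (a), let $k\ge3$, and let $w_1$ and $w_k$ be pendant vertices of $T_1$ and $T_k$ such that $$0<g_{w_1,v_1}(a(T))\le g_{v,v_i}(a(T))\quad\text{for all } i\ne k \text{ and all pendant vertices } v \text{ of } T_i,$$ $$0<g_{w_k,v_k}(a(T))\le g_{v,v_i}(a(T))\quad\text{for all } i\ne 1 \text{ and all pendant vertices } v \text{ of } T_i.$$ Then the values of every Fiedler vector at $w_1$ and $w_k$ are nonzero and of opposite signs, and they are its extremal values: one is its maximum and the other its minimum. If $w_1$ is the only pendant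 vertex $v$ of $T_1$ with $g_{v,v_1}(a(T))=g_{w_1,v_1}(a(T))$, and $w_k$ is the only pendant vertex $v$ of $T_k$ with $g_{v,v_k}(a(T))=g_{w_k,v_k}(a(T))$, then the maximum and the minimum are attained only at these two vertices; in that case (FED) holds if and only if $w_1$ and $w_k$ are the endpoints of a longest path of $T$. If $w_1$ and $w_k$ are the only pendant vertices of $T_1$ and $T_k$, then (FED) holds. (c) Let $B$ be a finite tree with a root $r$, let $w,w'\ne r$ be pendant vertices of $B$, and let $v$ be a vertex of $B$ that lies on the path from $w$ to $r$ and on the path from $w'$ to $r$, such that the paths $w=u_1,\ldots,u_{d+1}=v$ and $w'=u_1',\ldots,u'_{d'+1}=v$ meet only in $v$ (for example $v=r$ with $w,w'$ in different branches at $r$); here $d=d(w,v)$ and $d'=d(w',v)$. Let $S_i$ and $S_i'$ be the trees associated with the vertices $u_i$ and $u_i'$ of these paths in $B$, and assume that $$-d-\sum_{i=1}^{d-1} i\,|V(S_{d+1-i})|>-d'-\sum_{i=1}^{d'-1} i\,|V(S'_{d'+1-i})|.$$ The two sides are the derivatives $g_{w,v}'(0)$ and $g_{w',v}'(0)$, and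 there is a $K$, depending only on $B,r,w,w',v$, such that the following holds: whenever $k\ge K$ and for some $i\in\{1,\ldots,k\}$ the tree $T_i$ with root $v_i$ is isomorphic to $B$ with root $r$, then the entries $x,x'$ of every Fiedler vector of $T$ at the vertices corresponding to $w,w'$ satisfy $x\neq0$ and $\frac{x'}{x}\ge1$ if the entry at $v_i$ is nonzero, and $x=x'=0$ if the entry at $v_i$ is zero. -/

import Mathlib

universe u v

noncomputable section

namespace GenCaterpillar

/-- The graph Laplacian `L(G) = D - A` as a real matrix. -/
def lap {V : Type*} [Fintype V] (G : SimpleGraph V) : Matrix V V ℝ :=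
  open Classical in G.lapMatrix ℝ

/-- The (doubly) reduced Laplacian `L_D(G[S])`: the Laplacian of the subgraph of `G` induced on `S`
(vertex degrees taken in that subgraph), with the rows and columns indexed by `D` deleted. -/
def reducedLap {V : Type*} [Fintype V] (G : SimpleGraph V) (S D : Set V) :
    Matrix ↥(S \ D) ↥(S \ D) ℝ :=
  open Classical in fun x y => lap (G.induce S) ⟨x.1, x.2.1⟩ ⟨y.1, y.2.1⟩

/-- The smallest eigenvalue of a real symmetric matrix. -/
def lambdaMin {ι : Type*} [Finite ι] (M : Matrix ι ι ℝ) : ℝ :=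
  open Classical in
  letI := Fintype.ofFinite ι
  sInf (spectrum ℝ M)

/-- `a(G)`, the smallest nonzero eigenvalue of the Laplacian (for a connected graph on at
least two vertices: the algebraic connectivity). -/
def algConn {V : Type*} [Fintype V] (G : SimpleGraph V) : ℝ :=
  open Classical in sInf {μ : ℝ | μ ∈ spectrum ℝ (lap G) ∧ μ ≠ 0}

/-- The eigenspace of the Laplacian for `a(G)`. -/
def fiedlerSpace {V : Type*} [Fintype V] (G : SimpleGraph V) : Submodule ℝ (V → ℝ) :=
  open Classical in Module.End.eigenspace (Matrix.toLin' (lap G)) (algConn G)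

/-- `a(G)` is a simple eigenvalue of the (symmetric) Laplacian. -/
def AlgConnSimple {V : Type*} [Fintype V] (G : SimpleGraph V) : Prop :=
  Module.finrank ℝ (fiedlerSpace G) = 1

/-- `x` is an eigenvector of the Laplacian for `a(G)`. -/
def IsFiedlerVector {V : Type*} [Fintype V] (G : SimpleGraph V) (x : V → ℝ) : Prop :=
  x ∈ fiedlerSpace G ∧ x ≠ 0

/-- `p 0, p 1, …` are the successive, pairwise distinct vertices of a path in `G`. -/
def IsVertexPath {V : Type*} (G : SimpleGraph V) {k : ℕ} (p : Fin k → V) : Prop :=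
  Function.Injective p ∧ ∀ i j : Fin k, (i : ℕ) + 1 = (j : ℕ) → G.Adj (p i) (p j)

/-- The vertex set of the tree associated with the `i`-th vertex of the path `p`: all vertices that
can be joined to `p i` without meeting another vertex of the path. -/
def attached {V : Type*} (G : SimpleGraph V) {k : ℕ} (p : Fin k → V) (i : Fin k) : Set V :=
  {y | ∃ q : G.Walk y (p i), ∀ j : Fin k, p j ∈ q.support → j = i}

/-- The vertex set of the branch at `c` containing `y` (for `y ≠ c`): the vertex `c` together with
all vertices that can be joined to `y` without meeting `c`. In a tree this is also the vertex set of
the union of the path `y = u₁, …, uₘ = c` and the trees associated with `u₁, …, uₘ₋₁`. -/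
def branch {V : Type*} (G : SimpleGraph V) (c y : V) : Set V :=
  insert c {z | ∃ q : G.Walk z y, c ∉ q.support}

/-- `y` is a vertex of the `i`-th associated tree, different from the path vertex `p i`, whose
degree in that tree is one. -/
def IsPendantOf {V : Type*} (G : SimpleGraph V) {k : ℕ} (p : Fin k → V) (i : Fin k) (y : V) :
    Prop :=
  y ∈ attached G p i ∧ y ≠ p i ∧ (G.neighborSet y ∩ attached G p i).ncard = 1

/-- The indicator vector of the neighbours of `z` in a vertex set `R`. -/
def nbrVec {V : Type*} (G : SimpleGraph V) (z : V) (R : Set V) : R → ℝ :=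
  open Classical in fun y => if G.Adj z y then 1 else 0

/-- The function `g_{y,c}(t) = (1 - t - e₁ᵀ (M - t)⁻¹ e₁) / (e₂ᵀ (M - t)⁻¹ e₁)`, where `M` is the
Laplacian of the branch at `c` containing the pendant vertex `y`, with the rows and columns of `y`
and `c` deleted, and `e₁`, `e₂` are the unit vectors at the neighbour of `y` and at the neighbour of
`c` in the branch. If `y` and `c` are adjacent, the branch is the edge `yc` and
`g_{y,c}(t) = 1 - t`, in accordance with `(1 - t) x_y = x_c` for eigenvectors `x`. -/
def ratioFn {V : Type*} [Fintype V] (G : SimpleGraph V) (y c : V) (t : ℝ) : ℝ :=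
  open Classical in
  let R : Set V := branch G c y \ {y, c}
  let N : Matrix R R ℝ := (reducedLap G (branch G c y) {y, c} - t • (1 : Matrix R R ℝ))⁻¹
  if G.Adj y c then 1 - t
  else (1 - t - nbrVec G y R ⬝ᵥ N.mulVec (nbrVec G y R)) /
    (nbrVec G c R ⬝ᵥ N.mulVec (nbrVec G y R))

/-- For a path `q 0, …, q m` with associated trees `S_0, …, S_m`, the integer
`-m - ∑_{j=1}^{m-1} (m - j) |V(S_j)|`. -/
def pathSlope {V : Type*} (G : SimpleGraph V) {m : ℕ} (q : Fin (m + 1) → V) : ℤ :=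
  -(m : ℤ) - ∑ j : Fin (m + 1),
    if 0 < (j : ℕ) then ((m : ℤ) - (j : ℕ)) * ((attached G q j).ncard : ℤ) else 0

/-- `x` has its maximum exactly at one of the vertices `y`, `z` and its minimum exactly at the
other one. -/
def OnlyExtrema {V : Type*} (x : V → ℝ) (y z : V) : Prop :=
  ((∀ s, s ≠ y → x s < x y) ∧ (∀ s, s ≠ z → x z < x s)) ∨
    ((∀ s, s ≠ z → x s < x z) ∧ (∀ s, s ≠ y → x y < x s))

/-- `y` and `z` are the endpoints of a longest path of the tree `G`. -/
def EndsOfLongestPath {V : Type*} (G : SimpleGraph V) (y z : V) : Prop :=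
  ∀ s t : V, G.dist s t ≤ G.dist y z

/-- The Fiedler extrema diameter property of a tree: `a(G)` is simple, and the Fiedler vector has
only two extrema, which are located at the endpoints of a longest path. -/
def HasFED {V : Type*} [Fintype V] (G : SimpleGraph V) : Prop :=
  AlgConnSimple G ∧ ∃ y z : V, EndsOfLongestPath G y z ∧
    ∀ x : V → ℝ, IsFiedlerVector G x → OnlyExtrema x y z

/-- `a(G)` is smaller than the least eigenvalue of the reduced Laplacian, with respect to the path
vertex `p i`, of every branch at `p i` of the associated tree; the branches are
indexed by the neighbours of `p i` in that tree. -/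
def BranchCondition {V : Type*} [Fintype V] (G : SimpleGraph V) {k : ℕ} (p : Fin k → V) : Prop :=
  ∀ (i : Fin k) (y : V), y ∈ attached G p i → G.Adj (p i) y →
    algConn G < lambdaMin (reducedLap G (branch G (p i) y) {p i})

end GenCaterpillar

end

/-!
Everything rests on one flow identity. If `c u` is an edge of a tree and `A` is the side of `u`,
then summing `L x` over `A` leaves only the contribution of that edge, so that
`∑_{z ∈ A} (L x)(z) = x u - x c` (`sum_comp_laplace`). For a solution of `L x = t x` the increment
of `x` along an edge is thus `t` times the sum of `x` over the side the edge points to.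

The branch condition says that `L - a(T)` is positive definite on the functions supported in a
branch without its root (`PosOn`). By the minimum principle (`PosOn.nonneg`, `PosOn.pos`) an
eigenvector is then determined on an attached tree by its value at the root, and it has the sign
of that value throughout. Together with the flow identity along the path, the value at the first
path vertex determines everything, so `a(T)` is simple.

For the location of the extrema, a nodal domain argument (`not_pos_on_two_components`) shows that
the values along the path change sign only once; as the total sum vanishes, all partial sums are
positive, and the flow identity makes the values strictly monotone along the path. On the attached
trees where it is positive, an eigenvector increases away from the path, so that its maximum sits
at a pendant vertex. There `g_{v,c} x_v = x_c` (`ratioFn_mul`), and the pendant vertex with the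
smallest ratio in the tree with the largest root value wins. If that tree has a single pendant
vertex, it is a path; a Sturm comparison along the path from a pendant vertex to its root shows
that among all branches with a given ratio bound the bare path is the deepest
(`PosBranches.dist_le`), which places the extrema at the ends of a longest path.

For the last part, let `Y_t` be the solution on a branch at `c` with value `1` at `c`. Then
`g_{w,c}(t) = 1 / Y_t(w)`, and summing the flow identity along the path `w = u_0, …, u_m = c`
gives `Y_t(w) - 1 = t ∑_l (m - l) ∑_{S_l} Y_t`. Since `Y_t → 1` as `t → 0`, this is the derivative
of `g` at `0` (`hasDerivAt_ratioFn`). Both ratio functions have the value `1` at `0`, so the one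
with the larger slope dominates for small positive `t`, with a threshold depending on `B` alone.
Finally `a(T)` falls below any threshold once `T` contains a long path (`algConn_mul_le_of_path`),
whatever is attached to it.
-/

namespace GenCaterpillar

open Finset Matrix

/-! ### The Laplacian as an operator; positivity on a set of vertices -/

/-- The Laplacian as an operator on functions on the vertices. -/
noncomputable def laplace {V : Type*} [Fintype V] (G : SimpleGraph V) : (V → ℝ) →ₗ[ℝ] (V → ℝ) :=
  (lap G).mulVecLin

section Laplace
open scoped Classical
variable {V : Type*} [Fintype V] {G : SimpleGraph V}

theorem laplace_apply (f : V → ℝ) (z : V) :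
    laplace G f z = ∑ u, if G.Adj z u then f z - f u else 0 := by
  rw [laplace, Matrix.mulVecLin_apply, lap, SimpleGraph.lapMatrix_mulVec_apply,
    ← SimpleGraph.card_neighborFinset_eq_degree, ← nsmul_eq_mul, ← Finset.sum_const,
    ← Finset.sum_sub_distrib, ← Finset.sum_filter]
  congr 1
  ext u
  simp

theorem lap_isHermitian (G : SimpleGraph V) : (lap G).IsHermitian :=
  SimpleGraph.isHermitian_lapMatrix ℝ G

theorem sum_mul_laplace_comm (f g : V → ℝ) :
    ∑ z, f z * laplace G g z = ∑ z, g z * laplace G f z := by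
  have h := Matrix.dotProduct_mulVec f (lap G) g
  rw [← Matrix.mulVec_transpose] at h
  have ht : (lap G)ᵀ = lap G := SimpleGraph.isSymm_lapMatrix (R := ℝ) G
  rw [ht, dotProduct_comm (lap G *ᵥ f)] at h
  exact h

theorem laplace_const (c : ℝ) : laplace G (fun _ => c) = 0 := by
  ext z; simp [laplace_apply]

theorem sum_laplace (f : V → ℝ) : ∑ z, laplace G f z = 0 := by
  have := sum_mul_laplace_comm (G := G) (fun _ => 1) f
  simpa [laplace_const] using this

theorem energy_nonneg (f : V → ℝ) : 0 ≤ ∑ z, f z * laplace G f z := by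
  have h := (SimpleGraph.posSemidef_lapMatrix ℝ G).dotProduct_mulVec_nonneg f
  rw [star_trivial] at h
  exact h

theorem laplace_eq_zero_of_energy {f : V → ℝ} (h : ∑ z, f z * laplace G f z = 0) :
    laplace G f = 0 := by
  have h' := ((SimpleGraph.posSemidef_lapMatrix ℝ G).dotProduct_mulVec_zero_iff f).1
  rw [star_trivial] at h'
  exact h' h

theorem eq_of_laplace_eq_zero (hG : G.Connected) {f : V → ℝ} (h : laplace G f = 0) (y z : V) :
    f y = f z :=
  (SimpleGraph.lapMatrix_mulVec_eq_zero_iff_forall_reachable G).1 h y z (hG.preconnected y z)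

/-- A lower bound for the spectrum of a symmetric matrix bounds its quadratic form from below. -/
theorem le_quadratic_of_le_spectrum {ι : Type*} [Fintype ι] [DecidableEq ι] {M : Matrix ι ι ℝ}
    (hM : M.IsHermitian) {t : ℝ} (h : ∀ μ ∈ spectrum ℝ M, t ≤ μ) (f : ι → ℝ) :
    t * ∑ i, f i ^ 2 ≤ f ⬝ᵥ M *ᵥ f := by
  have hH : (M - t • (1 : Matrix ι ι ℝ)).IsHermitian :=
    hM.sub (Matrix.isHermitian_one.smul (IsSelfAdjoint.all t))
  have hps : (M - t • (1 : Matrix ι ι ℝ)).PosSemidef := by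
    rw [Matrix.posSemidef_iff_isHermitian_and_spectrum_nonneg]
    refine ⟨hH, fun μ hμ => ?_⟩
    have h2 : μ ∈ spectrum ℝ (M - algebraMap ℝ _ t) := by
      rwa [Algebra.algebraMap_eq_smul_one]
    rw [← spectrum.sub_singleton_eq] at h2
    obtain ⟨ν, hν, s, hs, rfl⟩ := h2
    rw [Set.mem_singleton_iff] at hs
    subst hs
    exact sub_nonneg.2 (h ν hν)
  have := hps.dotProduct_mulVec_nonneg f
  rw [star_trivial, Matrix.sub_mulVec, dotProduct_sub, Matrix.smul_mulVec, Matrix.one_mulVec,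
    dotProduct_smul, smul_eq_mul] at this
  have h3 : f ⬝ᵥ f = ∑ i, f i ^ 2 := by simp [dotProduct, sq]
  rw [h3] at this
  linarith

theorem mem_spectrum_lap_iff {μ : ℝ} :
    μ ∈ spectrum ℝ (lap G) ↔ ∃ f : V → ℝ, f ≠ 0 ∧ laplace G f = μ • f := by
  rw [← Matrix.spectrum_toLin', ← Module.End.hasEigenvalue_iff_mem_spectrum]
  constructor
  · intro h
    obtain ⟨f, hf⟩ := h.exists_hasEigenvector
    exact ⟨f, hf.2, hf.apply_eq_smul⟩
  · rintro ⟨f, hf, h⟩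
    exact Module.End.hasEigenvalue_of_hasEigenvector (Module.End.hasEigenvector_iff.2
      ⟨Module.End.mem_eigenspace_iff.2 h, hf⟩)

theorem mem_fiedlerSpace_iff {x : V → ℝ} :
    x ∈ fiedlerSpace G ↔ laplace G x = algConn G • x :=
  Module.End.mem_eigenspace_iff

theorem spectrum_lap_nonneg {μ : ℝ} (h : μ ∈ spectrum ℝ (lap G)) : 0 ≤ μ :=
  ((Matrix.posSemidef_iff_isHermitian_and_spectrum_nonneg).1
    (SimpleGraph.posSemidef_lapMatrix ℝ G)).2 h

theorem algConn_le {μ : ℝ} (h : μ ∈ spectrum ℝ (lap G)) (h0 : μ ≠ 0) : algConn G ≤ μ :=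
  csInf_le ⟨0, fun _ hν => spectrum_lap_nonneg hν.1⟩ ⟨h, h0⟩

theorem algConn_mem [Nontrivial V] (hG : G.Connected) :
    algConn G ∈ {μ : ℝ | μ ∈ spectrum ℝ (lap G) ∧ μ ≠ 0} := by
  have hfin : (spectrum ℝ (lap G)).Finite := by
    rw [(lap_isHermitian G).spectrum_real_eq_range_eigenvalues]
    exact Set.finite_range _
  refine Set.Nonempty.csInf_mem ?_ (hfin.subset fun _ h => h.1)
  by_contra hne
  rw [Set.not_nonempty_iff_eq_empty] at hne
  have hz : ∀ μ ∈ spectrum ℝ (lap G), μ = 0 := fun μ hμ => by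
    by_contra h
    exact (Set.eq_empty_iff_forall_notMem.1 hne) μ ⟨hμ, h⟩
  have h0 : lap G = 0 := by
    rw [← (lap_isHermitian G).eigenvalues_eq_zero_iff]
    ext i
    exact hz _ ((lap_isHermitian G).eigenvalues_mem_spectrum_real i)
  obtain ⟨y, z, hyz⟩ := exists_pair_ne V
  have := eq_of_laplace_eq_zero hG (f := Pi.single y 1) (by simp [laplace, h0]) y z
  simp [hyz.symm] at this

theorem algConn_pos [Nontrivial V] (hG : G.Connected) : 0 < algConn G :=
  lt_of_le_of_ne (spectrum_lap_nonneg (algConn_mem hG).1) (algConn_mem hG).2.symm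

theorem exists_isFiedlerVector [Nontrivial V] (hG : G.Connected) :
    ∃ x, IsFiedlerVector G x := by
  obtain ⟨f, hf, h⟩ := mem_spectrum_lap_iff.1 (algConn_mem hG).1
  exact ⟨f, mem_fiedlerSpace_iff.2 h, hf⟩

theorem IsFiedlerVector.laplace_apply {x : V → ℝ} (hx : IsFiedlerVector G x) (z : V) :
    laplace G x z = algConn G * x z := by
  rw [mem_fiedlerSpace_iff.1 hx.1]; rfl

theorem IsFiedlerVector.sum_eq_zero [Nontrivial V] (hG : G.Connected) {x : V → ℝ}
    (hx : IsFiedlerVector G x) : ∑ z, x z = 0 := by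
  have h := sum_laplace (G := G) x
  simp_rw [hx.laplace_apply, ← Finset.mul_sum] at h
  exact (mul_eq_zero.1 h).resolve_left (algConn_pos hG).ne'

/-- The matrix whose positivity expresses the variational characterization of `a(G)`: the
Laplacian, shifted by `a(G)` on the complement of the constants. -/
noncomputable def shiftedLap (G : SimpleGraph V) : Matrix V V ℝ :=
  lap G - algConn G • (1 : Matrix V V ℝ)
    + (algConn G / Fintype.card V) • (Matrix.of fun _ _ => (1 : ℝ))

theorem shiftedLap_mulVec (f : V → ℝ) (z : V) :
    (shiftedLap G *ᵥ f) z =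
      laplace G f z - algConn G * f z + algConn G / Fintype.card V * ∑ u, f u := by
  rw [shiftedLap, Matrix.add_mulVec, Matrix.sub_mulVec, Matrix.smul_mulVec, Matrix.smul_mulVec,
    Matrix.one_mulVec]
  simp [laplace, Matrix.mulVec, dotProduct]

theorem shiftedLap_isHermitian (G : SimpleGraph V) : (shiftedLap G).IsHermitian := by
  refine ((lap_isHermitian G).sub (Matrix.isHermitian_one.smul (IsSelfAdjoint.all _))).add
    (Matrix.IsHermitian.smul ?_ (IsSelfAdjoint.all _))
  ext i j; simp

/-- An eigenvector for a negative eigenvalue would be orthogonal to the constants, hence an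
eigenvector of the Laplacian for an eigenvalue below `a(G)`. -/
theorem shiftedLap_posSemidef (hG : G.Connected) : (shiftedLap G).PosSemidef := by
  rw [Matrix.posSemidef_iff_isHermitian_and_spectrum_nonneg]
  refine ⟨shiftedLap_isHermitian G, fun μ hμ => ?_⟩
  rw [← Matrix.spectrum_toLin', ← Module.End.hasEigenvalue_iff_mem_spectrum] at hμ
  obtain ⟨f, hf⟩ := hμ.exists_hasEigenvector
  by_contra hneg
  replace hneg : μ < 0 := not_le.1 hneg
  have hne := hf.2
  have heq : ∀ z, laplace G f z - algConn G * f z + algConn G / Fintype.card V * ∑ u, f u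
      = μ * f z := fun z => by
    rw [← shiftedLap_mulVec]; exact congrFun hf.apply_eq_smul z
  have := hG.nonempty
  have hcard : (Fintype.card V : ℝ) ≠ 0 := by positivity
  have hsum : ∑ u, f u = 0 := by
    have h1 := Finset.sum_congr (rfl : (univ : Finset V) = univ) fun z _ => heq z
    rw [Finset.sum_add_distrib, Finset.sum_sub_distrib, sum_laplace, ← Finset.mul_sum,
      Finset.sum_const, nsmul_eq_mul, Finset.card_univ] at h1
    have h2 : μ * ∑ u, f u = 0 := by rw [Finset.mul_sum, ← h1]; field_simp; ring
    exact (mul_eq_zero.1 h2).resolve_left hneg.ne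
  have hl : laplace G f = (algConn G + μ) • f := by
    ext z
    have := heq z
    rw [hsum] at this
    simp only [Pi.smul_apply, smul_eq_mul]
    linarith
  by_cases h0 : algConn G + μ = 0
  · rw [h0, zero_smul] at hl
    apply hne
    ext z
    have hc : ∀ u, f u = f z := fun u => eq_of_laplace_eq_zero hG hl u z
    rw [Finset.sum_congr rfl fun u _ => hc u, Finset.sum_const, nsmul_eq_mul,
      Finset.card_univ] at hsum
    exact (mul_eq_zero.1 hsum).resolve_left hcard
  · have := algConn_le (mem_spectrum_lap_iff.2 ⟨f, hne, hl⟩) h0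
    linarith

theorem shiftedLap_quadratic {f : V → ℝ} (hf : ∑ z, f z = 0) :
    f ⬝ᵥ shiftedLap G *ᵥ f = ∑ z, f z * laplace G f z - algConn G * ∑ z, f z ^ 2 := by
  simp only [dotProduct, shiftedLap_mulVec, hf, mul_zero, add_zero, Finset.mul_sum,
    ← Finset.sum_sub_distrib]
  exact Finset.sum_congr rfl fun z _ => by ring

/-- `a(G)` is a lower bound for the Rayleigh quotients of the functions orthogonal to the
constants. -/
theorem algConn_mul_le (hG : G.Connected) {f : V → ℝ} (hf : ∑ z, f z = 0) :
    algConn G * ∑ z, f z ^ 2 ≤ ∑ z, f z * laplace G f z := by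
  have h := (shiftedLap_posSemidef hG).dotProduct_mulVec_nonneg f
  rw [star_trivial, shiftedLap_quadratic hf] at h
  linarith

/-- A function orthogonal to the constants whose Rayleigh quotient attains the bound `a(G)` is an
eigenvector. -/
theorem mem_fiedlerSpace_of_le (hG : G.Connected) {f : V → ℝ} (hf : ∑ z, f z = 0)
    (h : ∑ z, f z * laplace G f z ≤ algConn G * ∑ z, f z ^ 2) : f ∈ fiedlerSpace G := by
  have h0 := ((shiftedLap_posSemidef hG).dotProduct_mulVec_zero_iff f).1 (by
    rw [star_trivial, shiftedLap_quadratic hf]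
    linarith [algConn_mul_le hG hf])
  rw [mem_fiedlerSpace_iff]
  ext z
  have := congrFun h0 z
  rw [shiftedLap_mulVec, hf] at this
  simp only [Pi.zero_apply] at this
  simp only [Pi.smul_apply, smul_eq_mul]
  linarith

/-- `L(G) - t` is positive definite on the functions supported in `D`; equivalently, `t` is smaller
than the least eigenvalue of the principal submatrix of `L(G)` with index set `D`. -/
def PosOn (G : SimpleGraph V) (D : Set V) (t : ℝ) : Prop :=
  ∀ f : V → ℝ, (∀ z ∉ D, f z = 0) → f ≠ 0 → t * ∑ z, f z ^ 2 < ∑ z, f z * laplace G f z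

theorem PosOn.mono {D D' : Set V} {t : ℝ} (h : PosOn G D t) (hD : D' ⊆ D) : PosOn G D' t :=
  fun f hf => h f fun z hz => hf z fun hz' => hz (hD hz')

theorem PosOn.eq_zero {D : Set V} {t : ℝ} (h : PosOn G D t) {f : V → ℝ} (hf : ∀ z ∉ D, f z = 0)
    (hL : ∀ z ∈ D, laplace G f z = t * f z) : f = 0 := by
  by_contra hne
  refine (h f hf hne).ne ?_
  rw [Finset.mul_sum]
  refine Finset.sum_congr rfl fun z _ => ?_
  by_cases hz : z ∈ D
  · rw [hL z hz]; ring
  · rw [hf z hz]; ring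

/-- The Dirichlet problem for `L(G) - t` on `D` is solvable. -/
theorem PosOn.exists_solution {D : Set V} {t : ℝ} (h : PosOn G D t) (b : V → ℝ) :
    ∃ y : V → ℝ, (∀ z ∉ D, y z = b z) ∧ ∀ z ∈ D, laplace G y z = t * y z := by
  let Φ : (V → ℝ) →ₗ[ℝ] (V → ℝ) :=
    { toFun := fun f z => if z ∈ D then laplace G f z - t * f z else f z
      map_add' := fun f g => by
        ext z; by_cases hz : z ∈ D <;> simp [hz]; ring
      map_smul' := fun c f => by
        ext z; by_cases hz : z ∈ D <;> simp [hz]; ring }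
  have hΦ : ∀ f z, Φ f z = if z ∈ D then laplace G f z - t * f z else f z := fun _ _ => rfl
  have hinj : Function.Injective Φ := by
    rw [← LinearMap.ker_eq_bot, LinearMap.ker_eq_bot']
    intro f hf
    refine h.eq_zero (fun z hz => ?_) fun z hz => ?_
    · have := congrFun hf z
      rwa [hΦ, if_neg hz] at this
    · have := congrFun hf z
      rw [hΦ, if_pos hz, Pi.zero_apply] at this
      linarith
  obtain ⟨y, hy⟩ := LinearMap.surjective_of_injective hinj (fun z => if z ∈ D then 0 else b z)
  refine ⟨y, fun z hz => ?_, fun z hz => ?_⟩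
  · have := congrFun hy z
    simpa [hΦ, hz] using this
  · have := congrFun hy z
    rw [hΦ, if_pos hz] at this
    simp only [hz, if_true] at this
    linarith

/-- Minimum principle: a solution on `D` that is nonnegative outside `D` is nonnegative. -/
theorem PosOn.nonneg {D : Set V} {t : ℝ} (h : PosOn G D t) {y : V → ℝ} (hy : ∀ z ∉ D, 0 ≤ y z)
    (hL : ∀ z ∈ D, laplace G y z = t * y z) (z : V) : 0 ≤ y z := by
  -- Test with the negative part of `y`.
  set n : V → ℝ := fun z => max (-y z) 0 with hn
  have hn0 : n = 0 := by
    by_contra hne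
    have hlt := h n (fun z hz => by simp [hn, hy z hz]) hne
    refine hlt.not_ge ?_
    rw [Finset.mul_sum]
    refine Finset.sum_le_sum fun z _ => ?_
    rcases le_or_gt 0 (y z) with hz | hz
    · have : n z = 0 := by simp [hn, hz]
      simp [this]
    · have hzn : n z = -y z := by simp [hn, hz.le]
      have hzD : z ∈ D := by
        by_contra hz'
        exact absurd (hy z hz') (not_le.2 hz)
      have hle : laplace G n z ≤ -laplace G y z := by
        rw [GenCaterpillar.laplace_apply, GenCaterpillar.laplace_apply, ← Finset.sum_neg_distrib]
        refine Finset.sum_le_sum fun u _ => ?_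
        split_ifs
        · have : -y u ≤ n u := le_max_left _ _
          rw [hzn]; linarith
        · simp
      rw [hL z hzD] at hle
      have hpos : 0 ≤ n z := le_max_right _ _
      calc n z * laplace G n z ≤ n z * (-(t * y z)) := mul_le_mul_of_nonneg_left hle hpos
        _ = t * n z ^ 2 := by rw [hzn]; ring
  have := congrFun hn0 z
  simp only [hn, Pi.zero_apply] at this
  have h2 : -y z ≤ max (-y z) 0 := le_max_left _ _
  linarith

/-- On a connected graph the Laplacian is coercive on the functions that vanish at a vertex. -/
theorem exists_coercive (hG : G.Connected) (c : V) : ∃ ε > 0, ∀ f : V → ℝ, f c = 0 →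
    ε * ∑ z, f z ^ 2 ≤ ∑ z, f z * laplace G f z := by
  -- Adding a unit mass at `c` does not change the form on these functions and makes it definite.
  let P : Matrix V V ℝ := lap G + Matrix.diagonal (Pi.single c 1)
  have hP : ∀ f, f ⬝ᵥ P *ᵥ f = ∑ z, f z * laplace G f z + f c ^ 2 := fun f => by
    simp only [P, Matrix.add_mulVec, dotProduct_add]
    congr 1
    rw [dotProduct, Finset.sum_eq_single c]
    · simp [Matrix.mulVec_diagonal, sq]
    · intro z _ hz; simp [Matrix.mulVec_diagonal, hz]
    · simp
  have hPH : P.IsHermitian := (lap_isHermitian G).add (Matrix.isHermitian_diagonal _)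
  have hpd : P.PosDef := by
    refine .of_dotProduct_mulVec_pos hPH fun f hf => ?_
    rw [star_trivial, hP]
    have h1 := energy_nonneg (G := G) f
    rcases h1.eq_or_lt with h0 | h0
    · have hc := eq_of_laplace_eq_zero hG (laplace_eq_zero_of_energy h0.symm)
      have : f c ≠ 0 := fun h => hf (by ext z; rw [hc z c, h]; rfl)
      positivity
    · positivity
  have := hG.nonempty
  obtain ⟨i, hi⟩ := Finite.exists_min hPH.eigenvalues
  refine ⟨hPH.eigenvalues i, hpd.eigenvalues_pos i, fun f hf => ?_⟩
  have := le_quadratic_of_le_spectrum hPH (t := hPH.eigenvalues i) (fun μ hμ => by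
    rw [hPH.spectrum_real_eq_range_eigenvalues] at hμ
    obtain ⟨j, rfl⟩ := hμ
    exact hi j) f
  rw [hP, hf] at this
  linarith

theorem posOn_of_coercive {c : V} {ε t : ℝ} (h : ∀ f : V → ℝ, f c = 0 →
    ε * ∑ z, f z ^ 2 ≤ ∑ z, f z * laplace G f z) (ht : t < ε) : PosOn G {c}ᶜ t := by
  intro f hf hne
  refine lt_of_lt_of_le ?_ (h f (hf c (by simp)))
  refine mul_lt_mul_of_pos_right ht ?_
  obtain ⟨z, hz⟩ := Function.ne_iff.1 hne
  exact Finset.sum_pos' (fun _ _ => sq_nonneg _) ⟨z, Finset.mem_univ _, by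
    have : f z ≠ 0 := hz
    positivity⟩

theorem sum_set_coe (S : Set V) [Fintype S] (F : V → ℝ) :
    ∑ y : S, F y = ∑ u, if u ∈ S then F u else 0 := by
  rw [← Finset.sum_filter, Finset.sum_set_coe]
  congr 1
  ext; simp

/-- If all neighbours of `z` lie in `S`, the row `z` of the reduced Laplacian of `G[S]` is the row
of the Laplacian of `G`, up to the contributions of the deleted vertices. -/
theorem reducedLap_mulVec {S D : Set V} [Fintype ↥(S \ D)] (f : V → ℝ) (z : ↥(S \ D))
    (hz : ∀ u, G.Adj z u → u ∈ S) :
    (reducedLap G S D *ᵥ fun y => f y) z =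
      laplace G f z + ∑ u, if G.Adj z u then D.indicator f u else 0 := by
  have hzS : (z : V) ∈ S := z.2.1
  have hzD : (z : V) ∉ D := z.2.2
  have h1 : (reducedLap G S D *ᵥ fun y => f y) z
      = laplace (G.induce S) (fun y : S => if (y : V) ∈ D then 0 else f y) ⟨z, hzS⟩ := by
    have hF := sum_set_coe (S \ D) fun u =>
      if h : u ∈ S then lap (G.induce S) ⟨z, hzS⟩ ⟨u, h⟩ * (if u ∈ D then 0 else f u) else 0
    have hF' := sum_set_coe S fun u =>
      if h : u ∈ S then lap (G.induce S) ⟨z, hzS⟩ ⟨u, h⟩ * (if u ∈ D then 0 else f u) else 0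
    calc _ = _ := Finset.sum_congr rfl fun y _ => ?_
      _ = _ := hF
      _ = _ := Finset.sum_congr rfl fun u _ => ?_
      _ = _ := hF'.symm
      _ = _ := Finset.sum_congr rfl fun y _ => ?_
    · rw [dif_pos y.2.1, if_neg y.2.2]; rfl
    · by_cases hu : u ∈ S <;> by_cases hd : u ∈ D <;> simp [hu, hd]
    · rw [dif_pos y.2]
  rw [h1, laplace_apply, laplace_apply, ← Finset.sum_add_distrib]
  have hF := sum_set_coe S fun u =>
      if G.Adj z u then f z - (if u ∈ D then 0 else f u) else 0
  calc _ = _ := Finset.sum_congr rfl fun y _ => ?_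
    _ = _ := hF
    _ = _ := Finset.sum_congr rfl fun u _ => ?_
  · simp only [hzD, if_false]; rfl
  · by_cases ha : G.Adj z u
    · have := hz u ha
      by_cases hd : u ∈ D <;> simp [ha, hd, this]
    · simp [ha]

theorem reducedLap_isHermitian (S D : Set V) : (reducedLap G S D).IsHermitian := by
  ext x y
  exact (lap_isHermitian (G.induce S)).apply _ _

theorem lambdaMin_eq {ι : Type*} [Fintype ι] [DecidableEq ι] (M : Matrix ι ι ℝ) :
    lambdaMin M = sInf (spectrum ℝ M) := by
  unfold lambdaMin
  congr!

/-- A spectral parameter below the least eigenvalue of a reduced Laplacian of `G[S]` gives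
positivity, provided that the remaining vertices have all their neighbours in `S`. -/
theorem posOn_of_lt_lambdaMin {S D : Set V} {t : ℝ} (hS : ∀ z ∈ S \ D, ∀ u, G.Adj z u → u ∈ S)
    (ht : t < lambdaMin (reducedLap G S D)) : PosOn G (S \ D) t := by
  intro f hf hne
  have hH := reducedLap_isHermitian (G := G) S D
  have hfin : (spectrum ℝ (reducedLap G S D)).Finite := by
    rw [hH.spectrum_real_eq_range_eigenvalues]
    exact Set.finite_range _
  have h := le_quadratic_of_le_spectrum hH (t := lambdaMin (reducedLap G S D))
    (fun μ hμ => by rw [lambdaMin_eq]; exact csInf_le hfin.bddBelow hμ) (fun y => f y)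
  have hsq : ∑ y : ↥(S \ D), f y ^ 2 = ∑ z, f z ^ 2 := by
    rw [sum_set_coe (S \ D) fun u => f u ^ 2]
    refine Finset.sum_congr rfl fun u _ => ?_
    split_ifs with hu
    · rfl
    · simp [hf u hu]
  have hq : (fun y : ↥(S \ D) => f y) ⬝ᵥ reducedLap G S D *ᵥ (fun y => f y)
      = ∑ z, f z * laplace G f z := by
    calc _ = ∑ y : ↥(S \ D), f y * laplace G f y := Finset.sum_congr rfl fun y _ => ?_
      _ = _ := sum_set_coe (S \ D) fun u => f u * laplace G f u
      _ = _ := Finset.sum_congr rfl fun u _ => ?_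
    · rw [reducedLap_mulVec f y (hS y y.2), Finset.sum_eq_zero, add_zero]
      intro u _
      rw [ite_eq_right_iff]
      exact fun _ => Set.indicator_apply_eq_zero.2 fun hu => hf u fun h => h.2 hu
    · split_ifs with hu
      · rfl
      · simp [hf u hu]
  rw [hsq, hq] at h
  refine lt_of_lt_of_le (mul_lt_mul_of_pos_right ht ?_) h
  obtain ⟨z, hz⟩ := Function.ne_iff.1 hne
  exact Finset.sum_pos' (fun _ _ => sq_nonneg _) ⟨z, Finset.mem_univ _, by
    have : f z ≠ 0 := hz
    positivity⟩

theorem isUnit_reducedLap_sub {S D : Set V} [Fintype ↥(S \ D)] [DecidableEq ↥(S \ D)] {t : ℝ}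
    (hS : ∀ z ∈ S \ D, ∀ u, G.Adj z u → u ∈ S) (h : PosOn G (S \ D) t) :
    IsUnit (reducedLap G S D - t • (1 : Matrix ↥(S \ D) ↥(S \ D) ℝ)) := by
  rw [← Matrix.mulVec_injective_iff_isUnit]
  intro g g' hgg
  rw [← sub_eq_zero]
  have hk : (reducedLap G S D - t • (1 : Matrix ↥(S \ D) ↥(S \ D) ℝ)) *ᵥ (g - g') = 0 := by
    rw [Matrix.mulVec_sub]; exact sub_eq_zero.2 hgg
  set k := g - g'
  let f : V → ℝ := fun z => if hz : z ∈ S \ D then k ⟨z, hz⟩ else 0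
  have hfk : (fun y : ↥(S \ D) => f y) = k := by
    ext y; simp only [f, y.2, dite_true]
  have hf0 : ∀ z ∉ S \ D, f z = 0 := fun z hz => by simp only [f, hz, dite_false]
  have hf : f = 0 := h.eq_zero hf0 fun z hz => by
    have := congrFun hk ⟨z, hz⟩
    rw [Matrix.sub_mulVec, Matrix.smul_mulVec, Matrix.one_mulVec, ← hfk, Pi.sub_apply,
      reducedLap_mulVec f ⟨z, hz⟩ (hS z hz), Finset.sum_eq_zero, add_zero] at this
    · simp only [Pi.smul_apply, smul_eq_mul, Pi.zero_apply] at this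
      linarith
    · intro u _
      rw [ite_eq_right_iff]
      exact fun _ => Set.indicator_apply_eq_zero.2 fun hu => hf0 u fun h => h.2 hu
  rw [← hfk, hf]
  rfl

end Laplace

/-! ### The sides of an edge of a tree, and the flow identity -/

section Components
variable {V : Type*} {G : SimpleGraph V} {c c' u u' v y z : V}

/-- The vertices that can be joined to `u` without meeting `c`. For `u ≠ c` this is the component
of `G - c` containing `u`, that is, the branch at `c` containing `u` without `c` itself. -/
def comp (G : SimpleGraph V) (c u : V) : Set V := {z | ∃ q : G.Walk z u, c ∉ q.support}

theorem branch_eq (c u : V) : branch G c u = insert c (comp G c u) := rfl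

theorem notMem_comp : c ∉ comp G c u := fun ⟨q, hq⟩ => hq q.start_mem_support

theorem ne_of_mem_comp (h : z ∈ comp G c u) : z ≠ c := by
  rintro rfl; exact notMem_comp h

theorem ne_of_mem_comp' (h : z ∈ comp G c u) : u ≠ c := by
  obtain ⟨q, hq⟩ := h
  rintro rfl; exact hq q.end_mem_support

theorem self_mem_comp (h : u ≠ c) : u ∈ comp G c u := ⟨.nil, by simp [h.symm]⟩

theorem mem_comp_symm (h : z ∈ comp G c u) : u ∈ comp G c z := by
  obtain ⟨q, hq⟩ := h
  exact ⟨q.reverse, by simpa using hq⟩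

theorem mem_comp_trans (h : z ∈ comp G c u) (h' : u ∈ comp G c v) : z ∈ comp G c v := by
  obtain ⟨q, hq⟩ := h
  obtain ⟨q', hq'⟩ := h'
  exact ⟨q.append q', by simp [SimpleGraph.Walk.mem_support_append_iff, hq, hq']⟩

theorem comp_eq_of_mem (h : z ∈ comp G c u) : comp G c z = comp G c u :=
  Set.ext fun _ => ⟨fun hy => mem_comp_trans hy h, fun hy => mem_comp_trans hy (mem_comp_symm h)⟩

theorem mem_comp_of_adj (h : z ∈ comp G c u) (ha : G.Adj z y) (hy : y ≠ c) : y ∈ comp G c u := by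
  refine mem_comp_trans ⟨.cons ha.symm .nil, ?_⟩ h
  simp [hy.symm, (ne_of_mem_comp h).symm]

theorem adj_mem_comp (ha : G.Adj z y) (hy : y ≠ c) (hz : z ≠ c) : y ∈ comp G c z :=
  mem_comp_of_adj (self_mem_comp hz) ha hy

theorem mem_comp_of_mem_support {q : G.Walk z u} (hq : c ∉ q.support) (hy : y ∈ q.support) :
    y ∈ comp G c u := by
  classical
  exact ⟨q.dropUntil y hy, fun h => hq (q.support_dropUntil_subset_support hy h)⟩

theorem comp_subset (h : c' ∉ comp G c u) : comp G c u ⊆ comp G c' u := fun _ ⟨q, hq⟩ =>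
  ⟨q, fun hc => h (mem_comp_of_mem_support hq hc)⟩

/-- In an acyclic graph the two sides of an edge are disjoint. -/
theorem disjoint_comp (hG : G.IsAcyclic) (ha : G.Adj c u) (h : z ∈ comp G c u)
    (h' : z ∈ comp G u c) : False := by
  obtain ⟨q, hq⟩ := h
  obtain ⟨q', hq'⟩ := h'
  have hb := SimpleGraph.isBridge_iff_forall_walk_mem_edges.1
    (SimpleGraph.isAcyclic_iff_forall_adj_isBridge.1 hG ha.symm) (q.reverse.append q')
  rw [SimpleGraph.Walk.edges_append, List.mem_append] at hb
  rcases hb with hb | hb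
  · have := SimpleGraph.Walk.snd_mem_support_of_mem_edges _ hb
    exact hq (by simpa using this)
  · exact hq' (SimpleGraph.Walk.fst_mem_support_of_mem_edges _ hb)

theorem eq_of_adj_of_mem_comp (hG : G.IsAcyclic) (ha : G.Adj c u) (ha' : G.Adj c u')
    (h : u' ∈ comp G c u) : u' = u := by
  by_contra hne
  exact disjoint_comp hG ha h (adj_mem_comp ha' hne ha.ne)

theorem exists_adj_mem_comp (hG : G.Connected) (h : y ≠ c) : ∃ u, G.Adj c u ∧ y ∈ comp G c u := by
  obtain ⟨q⟩ := hG.preconnected y c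
  induction q with
  | nil => exact absurd rfl h
  | @cons a b d hab q ih =>
    by_cases hb : b = d
    · subst hb
      exact ⟨a, hab.symm, self_mem_comp h⟩
    · obtain ⟨u, hu, hbu⟩ := ih hb
      exact ⟨u, hu, mem_comp_of_adj hbu hab.symm h⟩

/-- A vertex `y ≠ c` of a tree that is not a leaf has a neighbour on the side opposite to `c`. -/
theorem exists_adj_notMem_comp (hG : G.IsTree) [Finite V] (hy : y ≠ c)
    (hdeg : (G.neighborSet y).ncard ≠ 1) :
    ∃ n, G.Adj y n ∧ c ∉ comp G y n := by
  obtain ⟨m, hm, hcm⟩ := exists_adj_mem_comp hG.connected hy.symm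
  have : ∃ n, G.Adj y n ∧ n ≠ m := by
    by_contra hno
    push Not at hno
    refine hdeg (Set.ncard_eq_one.2 ⟨m, ?_⟩)
    ext n
    exact ⟨fun h => hno n h, by rintro rfl; exact hm⟩
  obtain ⟨n, hn, hne⟩ := this
  refine ⟨n, hn, fun hc => hne ?_⟩
  exact eq_of_adj_of_mem_comp hG.isAcyclic hm hn (mem_comp_trans (mem_comp_symm hc) hcm)

theorem comp_subset_of_adj (hcy : c ≠ y) (hn : G.Adj y u)
    (hc : c ∉ comp G y u) : comp G y u ⊆ comp G c y \ {y} := by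
  intro z hz
  refine ⟨mem_comp_trans (comp_subset hc hz) ?_, fun h => ne_of_mem_comp hz h⟩
  refine adj_mem_comp hn ?_ hcy.symm
  rintro rfl
  exact hc (self_mem_comp hcy)

/-- Every branch contains a leaf. -/
theorem exists_leaf_mem_comp (hG : G.IsTree) [Finite V] (ha : G.Adj c u) :
    ∃ v ∈ comp G c u, (G.neighborSet v).ncard = 1 := by
  induction h : (comp G c u).ncard using Nat.strong_induction_on generalizing c u with
  | _ n ih =>
    by_cases hdeg : (G.neighborSet u).ncard = 1
    · exact ⟨u, self_mem_comp ha.ne', hdeg⟩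
    · obtain ⟨m, hm, hcm⟩ := exists_adj_notMem_comp hG ha.ne' hdeg
      have hsub := comp_subset_of_adj ha.ne hm hcm
      have hlt : (comp G u m).ncard < n := by
        rw [← h]
        refine Set.ncard_lt_ncard ⟨fun z hz => (hsub hz).1, fun hss => ?_⟩ (Set.toFinite _)
        exact notMem_comp (hss (self_mem_comp ha.ne'))
      obtain ⟨v, hv, hv1⟩ := ih _ hlt hm rfl
      exact ⟨v, (hsub hv).1, hv1⟩

theorem dist_eq_add (hG : G.Connected) {s t : V} (h : ∀ q : G.Walk s t, c ∈ q.support) :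
    G.dist s t = G.dist s c + G.dist c t := by
  classical
  refine le_antisymm hG.dist_triangle ?_
  obtain ⟨q, hq⟩ := hG.exists_walk_length_eq_dist s t
  rw [← hq, ← SimpleGraph.Walk.take_spec q (h q), SimpleGraph.Walk.length_append]
  exact add_le_add (SimpleGraph.dist_le _) (SimpleGraph.dist_le _)

theorem dist_eq_add_of_notMem_comp (hG : G.Connected) {s t : V} (h : s ∉ comp G c t) :
    G.dist s t = G.dist s c + G.dist c t :=
  dist_eq_add hG fun q => by_contra fun hq => h ⟨q, hq⟩

section Flow
open scoped Classical
variable [Fintype V]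

/-- The sum of `L x` over one side of an edge of a tree is the difference of `x` along the edge. -/
theorem sum_comp_laplace (hG : G.IsTree) (ha : G.Adj c u) (x : V → ℝ) :
    ∑ z with z ∈ comp G c u, laplace G x z = x u - x c := by
  -- The Laplacian of the indicator function of the side of `u` is `δ_u - δ_c`.
  have hL : ∀ z, laplace G (fun z => if z ∈ comp G c u then 1 else 0) z
      = (if z = u then 1 else 0) - (if z = c then 1 else 0) := by
    intro z
    rw [laplace_apply]
    have hterm : ∀ w, (if G.Adj z w then (if z ∈ comp G c u then (1 : ℝ) else 0) -
        (if w ∈ comp G c u then 1 else 0) else 0)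
        = (if w = c then (if z = u then 1 else 0) else 0)
          - (if w = u then (if z = c then 1 else 0) else 0) := by
      intro w
      have hu : u ∈ comp G c u := self_mem_comp ha.ne'
      have hc : c ∉ comp G c u := notMem_comp
      have hcu := ha.ne
      by_cases hzw : G.Adj z w
      · by_cases hz : z ∈ comp G c u
        · by_cases hw : w ∈ comp G c u
          · have := ne_of_mem_comp hz
            have := ne_of_mem_comp hw
            simp [*]
          · have hwc : w = c := by_contra fun h => hw (mem_comp_of_adj hz hzw h)
            subst hwc
            have := eq_of_adj_of_mem_comp hG.isAcyclic ha hzw.symm hz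
            subst this
            simp [hzw, hc, hu, hcu]
        · by_cases hw : w ∈ comp G c u
          · have hzc : z = c := by_contra fun h => hz (mem_comp_of_adj hw hzw.symm h)
            subst hzc
            have := eq_of_adj_of_mem_comp hG.isAcyclic ha hzw hw
            subst this
            simp [hzw, hc, hu, hcu.symm]
          · have h1 : z ≠ u := by rintro rfl; exact hz hu
            have h2 : w ≠ u := by rintro rfl; exact hw hu
            simp [hz, hw, h1, h2]
      · have h1 : ¬ (w = c ∧ z = u) := by rintro ⟨rfl, rfl⟩; exact hzw ha.symm
        have h2 : ¬ (w = u ∧ z = c) := by rintro ⟨rfl, rfl⟩; exact hzw ha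
        by_cases hwc : w = c <;> by_cases hwu : w = u <;> simp_all
    rw [Finset.sum_congr rfl fun w _ => hterm w, Finset.sum_sub_distrib]
    simp
  have h := sum_mul_laplace_comm (G := G) (fun z => if z ∈ comp G c u then 1 else 0) x
  rw [Finset.sum_filter]
  simp only [ite_mul, one_mul, zero_mul] at h
  rw [h]
  simp [hL, mul_sub]

theorem sum_comp_eigen (hG : G.IsTree) (ha : G.Adj c u) {x : V → ℝ} {t : ℝ}
    (hx : ∀ z ∈ comp G c u, laplace G x z = t * x z) :
    x u - x c = t * ∑ z with z ∈ comp G c u, x z := by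
  rw [← sum_comp_laplace hG ha, Finset.mul_sum]
  exact Finset.sum_congr rfl fun z hz => hx z (Finset.mem_filter.1 hz).2

/-- A nonnegative solution on `comp G c u` that is positive at the boundary vertex `c` is
positive. -/
theorem pos_of_nonneg (hG : G.Connected) {x : V → ℝ} {t : ℝ} (hu : u ≠ c)
    (hx : ∀ z ∈ comp G c u, laplace G x z = t * x z)
    (h0 : ∀ z ∈ comp G c u, 0 ≤ x z) (hc : 0 < x c) (hz : z ∈ comp G c u) : 0 < x z := by
  have step : ∀ z ∈ comp G c u, x z = 0 → ∀ w, G.Adj z w → x w = 0 := by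
    intro z hz hz0 w hw
    have h := hx z hz
    rw [hz0, mul_zero, laplace_apply, Finset.sum_eq_zero_iff_of_nonpos] at h
    · have := h w (Finset.mem_univ _)
      rw [if_pos hw, hz0] at this
      linarith
    · intro y _
      split_ifs with hy
      · rw [hz0, zero_sub, neg_nonpos]
        by_cases hyc : y = c
        · rw [hyc]; exact hc.le
        · exact h0 y (mem_comp_of_adj hz hy hyc)
      · exact le_rfl
  refine lt_of_le_of_ne (h0 z hz) fun hz0 => ?_
  obtain ⟨q⟩ := hG.preconnected z c
  induction q with
  | nil => exact notMem_comp hz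
  | @cons a b d hab q ih =>
    have hb := step a hz hz0.symm b hab
    by_cases hbd : b = d
    · subst hbd; linarith
    · exact ih hu hx h0 hc (mem_comp_of_adj hz hab hbd) step hb.symm

/-- Strong minimum principle: a solution on a component of `G - c` has the sign of its value at
`c`. -/
theorem PosOn.pos (hG : G.Connected) {x : V → ℝ} {t : ℝ} (h : PosOn G (comp G c u) t)
    (hx : ∀ z ∈ comp G c u, laplace G x z = t * x z) (hc : 0 < x c) (hz : z ∈ comp G c u) :
    0 < x z := by
  -- Only the values on the component and at `c` enter, so `x` may be cut off elsewhere.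
  let x' : V → ℝ := fun z => if z ∈ comp G c u ∨ z = c then x z else 0
  have hx'c : x' c = x c := by simp [x']
  have hx'z : ∀ z ∈ comp G c u, x' z = x z := fun z hz => by simp [x', hz]
  have hL : ∀ z ∈ comp G c u, laplace G x' z = t * x' z := by
    intro z hz
    rw [hx'z z hz, ← hx z hz, laplace_apply, laplace_apply]
    refine Finset.sum_congr rfl fun w _ => ?_
    split_ifs with hw
    · rw [hx'z z hz]
      congr 1
      by_cases hwc : w = c
      · rw [hwc, hx'c]
      · exact hx'z w (mem_comp_of_adj hz hw hwc)
    · rfl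
  have hn := h.nonneg (y := x') (fun w hw => by
    by_cases hwc : w = c
    · rw [hwc, hx'c]; exact hc.le
    · simp [x', hw, hwc]) hL
  rw [← hx'z z hz]
  exact pos_of_nonneg hG (ne_of_mem_comp' hz) hL (fun w _ => hn w) (hx'c ▸ hc) hz

theorem PosOn.eq_zero_of_boundary {x : V → ℝ} {t : ℝ} (h : PosOn G (comp G c u) t)
    (hx : ∀ z ∈ comp G c u, laplace G x z = t * x z) (hc : x c = 0) (hz : z ∈ comp G c u) :
    x z = 0 := by
  let x' : V → ℝ := fun z => if z ∈ comp G c u then x z else 0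
  have hx'z : ∀ z ∈ comp G c u, x' z = x z := fun z hz => by simp [x', hz]
  have h0 : x' = 0 := by
    refine h.eq_zero (fun z hz => by simp [x', hz]) fun z hz => ?_
    rw [hx'z z hz, ← hx z hz, laplace_apply, laplace_apply]
    refine Finset.sum_congr rfl fun w _ => ?_
    split_ifs with hw
    · rw [hx'z z hz]
      congr 1
      by_cases hwc : w = c
      · rw [hwc, hc]; simp [x', notMem_comp]
      · exact hx'z w (mem_comp_of_adj hz hw hwc)
    · rfl
  rw [← hx'z z hz, h0]; rfl

end Flow
end Components

/-! ### The ratio function of a pendant vertex -/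

section Ratio
open scoped Classical
variable {V : Type*} {G : SimpleGraph V} {c v : V} {t : ℝ}

theorem branch_diff_eq (c v : V) : branch G c v \ {c} = comp G c v := by
  ext z
  simp only [branch_eq, Set.mem_sdiff, Set.mem_insert_iff, Set.mem_singleton_iff]
  exact ⟨fun h => h.1.resolve_left h.2, fun h => ⟨Or.inr h, ne_of_mem_comp h⟩⟩

theorem adj_mem_branch {z u : V} (hz : z ∈ comp G c v) (h : G.Adj z u) : u ∈ branch G c v := by
  by_cases hu : u = c
  · exact Or.inl hu
  · exact Or.inr (mem_comp_of_adj hz h hu)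

variable [Fintype V]

theorem posOn_comp_of_lt_lambdaMin (h : t < lambdaMin (reducedLap G (branch G c v) {c})) :
    PosOn G (comp G c v) t := by
  have hS : ∀ z ∈ branch G c v \ {c}, ∀ u, G.Adj z u → u ∈ branch G c v := fun z hz u hu => by
    rw [branch_diff_eq] at hz
    exact adj_mem_branch hz hu
  have := posOn_of_lt_lambdaMin hS h
  rwa [branch_diff_eq] at this

theorem sum_nbrVec (R : Set V) [Fintype R] (z : V) (f : V → ℝ) :
    nbrVec G z R ⬝ᵥ (fun y : R => f y) = ∑ u, if u ∈ R ∧ G.Adj z u then f u else 0 := by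
  rw [dotProduct]
  have := sum_set_coe R fun u => if G.Adj z u then f u else 0
  calc _ = _ := Finset.sum_congr rfl fun y _ => ?_
    _ = _ := this
    _ = _ := Finset.sum_congr rfl fun u _ => ?_
  · simp only [nbrVec, ite_mul, one_mul, zero_mul]
  · by_cases h1 : u ∈ R <;> simp [h1]

theorem sum_adj_of_leaf (hv : (G.neighborSet v).ncard = 1) :
    ∑ u, (if G.Adj v u then (1 : ℝ) else 0) = 1 := by
  obtain ⟨n, hn⟩ := Set.ncard_eq_one.1 hv
  have : ∀ u, G.Adj v u ↔ u = n := fun u => by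
    rw [← SimpleGraph.mem_neighborSet, hn, Set.mem_singleton_iff]
  simp [this]

theorem laplace_leaf (hv : (G.neighborSet v).ncard = 1) (x : V → ℝ) :
    laplace G x v = x v - ∑ u, if G.Adj v u then x u else 0 := by
  have h : laplace G x v = x v * (∑ u, if G.Adj v u then (1 : ℝ) else 0)
      - ∑ u, if G.Adj v u then x u else 0 := by
    rw [laplace_apply, Finset.mul_sum, ← Finset.sum_sub_distrib]
    refine Finset.sum_congr rfl fun u _ => ?_
    split_ifs <;> ring
  rw [h, sum_adj_of_leaf hv, mul_one]

/-- The function `g_{v,c}` is the ratio of the values at `c` and `v` of the vectors that satisfy the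
eigenvalue equation on the branch at `c` containing `v`, outside `c`. -/
theorem ratioFn_mul (hG : G.Connected) (hvc : v ≠ c) (hv : (G.neighborSet v).ncard = 1)
    (h : PosOn G (comp G c v) t) {x : V → ℝ}
    (hx : ∀ z ∈ comp G c v, laplace G x z = t * x z) : ratioFn G v c t * x v = x c := by
  have hvm : v ∈ comp G c v := self_mem_comp hvc
  by_cases ha : G.Adj v c
  · have hr : ratioFn G v c t = 1 - t := if_pos ha
    obtain ⟨n, hn⟩ := Set.ncard_eq_one.1 hv
    have hN : ∀ u, G.Adj v u ↔ u = n := fun u => by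
      rw [← SimpleGraph.mem_neighborSet, hn, Set.mem_singleton_iff]
    have hcn : c = n := (hN c).1 ha
    have h1 := hx v hvm
    rw [laplace_leaf hv] at h1
    simp only [hN, Finset.sum_ite_eq', Finset.mem_univ, if_true, ← hcn] at h1
    rw [hr]; linarith
  set R : Set V := branch G c v \ {v, c} with hR
  set M : Matrix R R ℝ := reducedLap G (branch G c v) {v, c} - t • (1 : Matrix R R ℝ) with hM
  have hRD : R ⊆ comp G c v := by
    rw [← branch_diff_eq]
    exact Set.sdiff_subset_sdiff_right (by simp)
  have hRmem : ∀ z, z ∈ R ↔ z ∈ comp G c v ∧ z ≠ v := fun z => by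
    refine ⟨fun hz => ⟨hRD hz, fun hzv => hz.2 (by simp [hzv])⟩, fun hz => ⟨Or.inr hz.1, ?_⟩⟩
    simp [hz.2, ne_of_mem_comp hz.1]
  have hS : ∀ z ∈ R, ∀ u, G.Adj z u → u ∈ branch G c v := fun z hz u hu =>
    adj_mem_branch (hRD hz) hu
  have hunit : IsUnit M := isUnit_reducedLap_sub hS (h.mono hRD)
  have hdet : IsUnit M.det := (Matrix.isUnit_iff_isUnit_det _).1 hunit
  set e := nbrVec G v R
  set e' := nbrVec G c R
  have hr : ratioFn G v c t = (1 - t - e ⬝ᵥ M⁻¹ *ᵥ e) / (e' ⬝ᵥ M⁻¹ *ᵥ e) := by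
    rw [ratioFn]; exact if_neg ha
  -- A function on the vertices, seen by the reduced matrix.
  have hMf : ∀ (f : V → ℝ) (z : R), (M *ᵥ fun y => f y) z
      = laplace G f z - t * f z + f v * e z + f c * e' z := by
    intro f z
    rw [hM, Matrix.sub_mulVec, Matrix.smul_mulVec, Matrix.one_mulVec, Pi.sub_apply,
      reducedLap_mulVec f z (hS z z.2)]
    have hsum : ∑ u, (if G.Adj z u then ({v, c} : Set V).indicator f u else 0)
        = f v * e z + f c * e' z := by
      have hterm : ∀ u, (if G.Adj z u then ({v, c} : Set V).indicator f u else 0)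
          = (if u = v then f v * e z else 0) + (if u = c then f c * e' z else 0) := by
        intro u
        by_cases h1 : u = v
        · subst h1
          simp [e, nbrVec, hvc, SimpleGraph.adj_comm]
        · by_cases h2 : u = c
          · subst h2
            simp [e', nbrVec, h1, SimpleGraph.adj_comm]
          · simp [h1, h2]
      simp [hterm, Finset.sum_add_distrib]
    rw [hsum]
    simp only [Pi.smul_apply, smul_eq_mul]; ring
  have hev : ∀ f : V → ℝ, e ⬝ᵥ (fun y => f y) = ∑ u, if G.Adj v u then f u else 0 := by
    intro f
    rw [sum_nbrVec]
    refine Finset.sum_congr rfl fun u _ => ?_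
    by_cases hu : G.Adj v u
    · have : u ∈ R := (hRmem u).2 ⟨mem_comp_of_adj hvm hu (by rintro rfl; exact ha hu), hu.ne'⟩
      rw [if_pos ⟨this, hu⟩, if_pos hu]
    · simp [hu]
  have hMT : Mᵀ = M := by
    have h1 : (reducedLap G (branch G c v) {v, c})ᵀ = reducedLap G (branch G c v) {v, c} :=
      reducedLap_isHermitian _ _
    rw [hM, Matrix.transpose_sub, Matrix.transpose_smul, Matrix.transpose_one, h1]
  have hsymm : e ⬝ᵥ M⁻¹ *ᵥ e' = e' ⬝ᵥ M⁻¹ *ᵥ e := by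
    rw [Matrix.dotProduct_mulVec, ← Matrix.mulVec_transpose, Matrix.transpose_nonsing_inv, hMT,
      dotProduct_comm]
  -- The defining identity, numerator times `y v` equals denominator times `y c`.
  have key : ∀ y : V → ℝ, (∀ z ∈ comp G c v, laplace G y z = t * y z) →
      (1 - t - e ⬝ᵥ M⁻¹ *ᵥ e) * y v = (e' ⬝ᵥ M⁻¹ *ᵥ e) * y c := by
    intro y hy
    have h1 : M *ᵥ (fun z : R => y z) = y v • e + y c • e' := by
      ext z
      rw [hMf, hy z (hRD z.2)]
      simp
    have h2 : (fun z : R => y z) = y v • (M⁻¹ *ᵥ e) + y c • (M⁻¹ *ᵥ e') := by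
      rw [← Matrix.mulVec_smul, ← Matrix.mulVec_smul, ← Matrix.mulVec_add, ← h1,
        Matrix.mulVec_mulVec, Matrix.nonsing_inv_mul _ hdet, Matrix.one_mulVec]
    have h3 := hev y
    rw [h2, dotProduct_add, dotProduct_smul, dotProduct_smul, hsymm, smul_eq_mul, smul_eq_mul] at h3
    have h4 := hy v hvm
    rw [laplace_leaf hv, ← h3] at h4
    linarith
  have hden : e' ⬝ᵥ M⁻¹ *ᵥ e ≠ 0 := by
    intro hd
    obtain ⟨y, hy0, hy⟩ := h.exists_solution fun _ => 1
    have hyv := h.pos hG hy (by rw [hy0 c notMem_comp]; exact one_pos) hvm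
    have hnum := key y hy
    rw [hd, zero_mul, mul_eq_zero, or_iff_left hyv.ne'] at hnum
    -- Then `M⁻¹ e`, extended by `1` at `v`, contradicts the definiteness on the component.
    let f : V → ℝ := fun z => if hz : z ∈ R then (M⁻¹ *ᵥ e) ⟨z, hz⟩ else if z = v then 1 else 0
    have hfR : (fun z : R => f z) = M⁻¹ *ᵥ e := by
      ext z; simp only [f, z.2, dite_true]
    have hvR : v ∉ R := fun hz => ((hRmem v).1 hz).2 rfl
    have hfv : f v = 1 := by simp [f, hvR]
    have hf0 : ∀ z ∉ comp G c v, f z = 0 := fun z hz => by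
      have h1 : z ∉ R := fun h => hz (hRD h)
      have h2 : z ≠ v := by rintro rfl; exact hz hvm
      simp [f, h1, h2]
    have hf : f = 0 := h.eq_zero hf0 fun z hz => by
      by_cases hzv : z = v
      · subst hzv
        rw [laplace_leaf hv, ← hev, hfR, hfv]
        linarith
      · have hzR := (hRmem z).2 ⟨hz, hzv⟩
        have h1 := hMf f ⟨z, hzR⟩
        rw [hfR, Matrix.mulVec_mulVec, Matrix.mul_nonsing_inv _ hdet, Matrix.one_mulVec, hfv,
          hf0 c notMem_comp] at h1
        linarith
    rw [hf] at hfv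
    exact zero_ne_one hfv
  rw [hr, div_mul_eq_mul_div, key x hx, mul_comm]
  exact mul_div_cancel_right₀ _ hden

end Ratio

/-! ### The trees attached to a path -/

section Path
variable {V : Type*} {G : SimpleGraph V} {k : ℕ} {p : Fin k → V} {i j l m : Fin k} {u y z : V}

theorem IsVertexPath.exists_walk (hp : IsVertexPath G p) (n : ℕ) (h : (i : ℕ) + n = j) :
    ∃ w : G.Walk (p i) (p j), w.length = n ∧ ∀ v ∈ w.support, ∃ l, i ≤ l ∧ l ≤ j ∧ v = p l := by
  induction n generalizing i with
  | zero =>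
    obtain rfl : i = j := Fin.ext (by simpa using h)
    exact ⟨.nil, rfl, fun v hv => ⟨i, le_rfl, le_rfl, by simpa using hv⟩⟩
  | succ n ih =>
    have hlt : (i : ℕ) + 1 < k := by omega
    obtain ⟨w, hw, hs⟩ := ih (i := ⟨i + 1, hlt⟩) (by simp only; omega)
    refine ⟨.cons (hp.2 i ⟨i + 1, hlt⟩ rfl) w, by simp [hw], fun v hv => ?_⟩
    rw [SimpleGraph.Walk.support_cons, List.mem_cons] at hv
    rcases hv with rfl | hv
    · exact ⟨i, le_rfl, Fin.le_def.2 (by omega), rfl⟩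
    · obtain ⟨l, h1, h2, h3⟩ := hs v hv
      exact ⟨l, (Fin.le_def.2 (by simp)).trans h1, h2, h3⟩

/-- The part of a path on one side of the vertex `p m` lies in one component of `G - p m`. -/
theorem IsVertexPath.mem_comp (hp : IsVertexPath G p) (h : (m < l ∧ m < i) ∨ (l < m ∧ i < m)) :
    p l ∈ comp G (p m) (p i) := by
  wlog hli : l ≤ i generalizing l i
  · exact mem_comp_symm (this (h.imp And.symm And.symm) (le_of_not_ge hli))
  obtain ⟨w, -, hw⟩ := hp.exists_walk (i := l) (j := i) (i - l) (by
    have := Fin.le_def.1 hli; omega)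
  refine ⟨w, fun hm => ?_⟩
  obtain ⟨n, h1, h2, h3⟩ := hw _ hm
  have := hp.1 h3
  subst this
  rcases h with h | h
  · exact absurd h.1 (not_lt.2 h1)
  · exact absurd h.2 (not_lt.2 h2)

theorem mem_comp_of_mem_attached (h : y ∈ attached G p i) (hm : m ≠ i) :
    y ∈ comp G (p m) (p i) := by
  obtain ⟨q, hq⟩ := h
  exact ⟨q, fun h => hm (hq m h)⟩

theorem self_mem_attached (hp : IsVertexPath G p) (i : Fin k) : p i ∈ attached G p i :=
  ⟨.nil, fun j hj => hp.1 (by simpa using hj)⟩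

theorem eq_of_mem_attached (hG : G.IsAcyclic) (hp : IsVertexPath G p) (hi : y ∈ attached G p i)
    (hj : y ∈ attached G p j) : i = j := by
  by_contra hne
  wlog hij : i < j generalizing i j
  · exact this hj hi (Ne.symm hne) (lt_of_le_of_ne (le_of_not_gt hij) (Ne.symm hne))
  have hlt := Fin.lt_def.1 hij
  have hk := j.2
  let i' : Fin k := ⟨i + 1, by omega⟩
  have hii' : i < i' := Fin.lt_def.2 (by simp [i'])
  refine disjoint_comp hG (hp.2 i i' rfl).symm (mem_comp_of_mem_attached hi hii'.ne') ?_
  exact mem_comp_trans (mem_comp_of_mem_attached hj hij.ne) (hp.mem_comp (Or.inl ⟨hij, hii'⟩))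

theorem eq_of_path_mem_attached (hG : G.IsAcyclic) (hp : IsVertexPath G p)
    (h : p j ∈ attached G p i) : j = i :=
  eq_of_mem_attached hG hp (self_mem_attached hp j) h

theorem mem_attached_of_adj (hz : z ∈ attached G p i)
    (hzu : G.Adj z u) (hu : ∀ j, j ≠ i → u ≠ p j) : u ∈ attached G p i := by
  obtain ⟨q, hq⟩ := hz
  refine ⟨.cons hzu.symm q, fun j hj => ?_⟩
  rw [SimpleGraph.Walk.support_cons, List.mem_cons] at hj
  rcases hj with hj | hj
  · by_contra hne; exact hu j hne hj.symm
  · exact hq j hj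

theorem mem_attached_of_adj_of_ne (hG : G.IsAcyclic) (hp : IsVertexPath G p)
    (hz : z ∈ attached G p i) (hzi : z ≠ p i) (hzu : G.Adj z u) : u ∈ attached G p i := by
  refine mem_attached_of_adj hz hzu ?_
  rintro j hj rfl
  refine hj (eq_of_mem_attached hG hp (mem_attached_of_adj (self_mem_attached hp j) hzu.symm ?_)
    hz)
  rintro l hl rfl
  exact hzi (congrArg p (eq_of_path_mem_attached hG hp hz))

theorem exists_mem_attached (hG : G.Connected) (hp : IsVertexPath G p) (hk : 1 ≤ k) (y : V) :
    ∃ i, y ∈ attached G p i := by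
  obtain ⟨q⟩ := hG.preconnected y (p ⟨0, hk⟩)
  generalize hv : p ⟨0, hk⟩ = v at q
  induction q with
  | nil => exact ⟨⟨0, hk⟩, hv ▸ self_mem_attached hp _⟩
  | @cons a b d hab q ih =>
    obtain ⟨i, hi⟩ := ih hv
    by_cases ha : ∃ j, a = p j
    · obtain ⟨j, rfl⟩ := ha
      exact ⟨j, self_mem_attached hp j⟩
    · exact ⟨i, mem_attached_of_adj hi hab.symm fun j _ h => ha ⟨j, h⟩⟩

/-- A component of `G - y` that meets an attached tree but does not contain its root lies in that
tree. -/
theorem comp_subset_attached (hG : G.IsAcyclic) (hp : IsVertexPath G p)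
    (hu : u ∈ attached G p i) (hi : p i ∉ comp G y u) : comp G y u ⊆ attached G p i \ {p i} := by
  rintro z ⟨q, hq⟩
  have hs : ∀ v ∈ q.support, v ≠ p i := by
    rintro v hv rfl
    exact hi (mem_comp_of_mem_support hq hv)
  refine ⟨?_, hs z q.start_mem_support⟩
  clear hq hi
  induction q with
  | nil => exact hu
  | @cons a b d hab q ih =>
    simp only [SimpleGraph.Walk.support_cons, List.mem_cons, forall_eq_or_imp] at hs
    exact mem_attached_of_adj_of_ne hG hp (ih hu hs.2) (hs.2 _ q.start_mem_support) hab.symm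

theorem exists_adj_of_mem_attached (hG : G.IsTree) (hp : IsVertexPath G p)
    (hy : y ∈ attached G p i) (hyi : y ≠ p i) :
    ∃ u ∈ attached G p i, G.Adj (p i) u ∧ y ∈ comp G (p i) u := by
  obtain ⟨u, hu, hyu⟩ := exists_adj_mem_comp hG.connected hyi
  exact ⟨u, (comp_subset_attached hG.isAcyclic hp hy notMem_comp (mem_comp_symm hyu)).1, hu, hyu⟩

/-- The side of `p i` of the path edge `p i, p (i + 1)` is the union of the trees attached up to
`i`. -/
theorem mem_comp_path_iff (hG : G.IsTree) (hp : IsVertexPath G p) (hij : (i : ℕ) + 1 = j) :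
    z ∈ comp G (p j) (p i) ↔ ∃ l ≤ i, z ∈ attached G p l := by
  have hlt : i < j := Fin.lt_def.2 (by omega)
  constructor
  · intro hz
    obtain ⟨l, hl⟩ := exists_mem_attached hG.connected hp (by have := i.2; omega) z
    refine ⟨l, ?_, hl⟩
    by_contra hli
    rw [not_le] at hli
    refine disjoint_comp hG.isAcyclic (hp.2 i j hij).symm hz ?_
    exact mem_comp_trans (mem_comp_of_mem_attached hl hli.ne) (hp.mem_comp (Or.inl ⟨hli, hlt⟩))
  · rintro ⟨l, hl, hz⟩
    have hlj := lt_of_le_of_lt hl hlt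
    exact mem_comp_trans (mem_comp_of_mem_attached hz hlj.ne')
      (hp.mem_comp (Or.inr ⟨hlj, hlt⟩))

theorem IsVertexPath.notMem_comp (hG : G.IsTree) (hp : IsVertexPath G p) (hji : j < i)
    (hil : i < l) : p l ∉ comp G (p i) (p j) := by
  intro h
  have h1 := Fin.lt_def.1 hji
  have h2 := Fin.lt_def.1 hil
  have hi := i.2
  let i' : Fin k := ⟨i - 1, by omega⟩
  have hi' : (i' : ℕ) = i - 1 := rfl
  have hi'i : i' < i := Fin.lt_def.2 (by omega)
  have h3 : p l ∈ comp G (p i) (p i') := mem_comp_trans h (hp.mem_comp (Or.inr ⟨hji, hi'i⟩))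
  obtain ⟨m, hm, hlm⟩ := (mem_comp_path_iff hG hp (by omega)).1 h3
  have := eq_of_path_mem_attached hG.isAcyclic hp hlm
  subst this
  exact absurd (hm.trans_lt (hi'i.trans hil)) (lt_irrefl _)

/-- The neighbours of a vertex of an attached tree, other than its root, lie in that tree, so a
pendant vertex is a leaf of the whole tree. -/
theorem isPendantOf_iff (hG : G.IsAcyclic) (hp : IsVertexPath G p) :
    IsPendantOf G p i y ↔ y ∈ attached G p i ∧ y ≠ p i ∧ (G.neighborSet y).ncard = 1 := by
  refine and_congr_right fun hy => and_congr_right fun hyi => ?_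
  have hsub : G.neighborSet y ⊆ attached G p i := fun u hu =>
    mem_attached_of_adj_of_ne hG hp hy hyi hu
  rw [Set.inter_eq_left.2 hsub]

/-- Beyond every vertex of an attached tree, other than its root, there is a pendant vertex. -/
theorem exists_pendant_beyond (hG : G.IsTree) [Finite V] (hp : IsVertexPath G p)
    (hy : y ∈ attached G p i) (hyi : y ≠ p i) :
    ∃ v, IsPendantOf G p i v ∧ (v = y ∨ v ∉ comp G y (p i)) := by
  by_cases hdeg : (G.neighborSet y).ncard = 1
  · exact ⟨y, (isPendantOf_iff hG.isAcyclic hp).2 ⟨hy, hyi, hdeg⟩, Or.inl rfl⟩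
  obtain ⟨n, hn, hin⟩ := exists_adj_notMem_comp hG hyi hdeg
  obtain ⟨v, hv, hv1⟩ := exists_leaf_mem_comp hG hn
  have hna := mem_attached_of_adj_of_ne hG.isAcyclic hp hy hyi hn
  have hva := comp_subset_attached hG.isAcyclic hp hna hin hv
  refine ⟨v, (isPendantOf_iff hG.isAcyclic hp).2 ⟨hva.1, hva.2, hv1⟩, Or.inr fun h => hin ?_⟩
  exact mem_comp_trans (mem_comp_symm h) hv

theorem dist_path_le (hp : IsVertexPath G p) (h : i ≤ j) : G.dist (p i) (p j) ≤ j - i := by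
  have := Fin.le_def.1 h
  obtain ⟨w, hw, -⟩ := hp.exists_walk (i := i) (j := j) (j - i) (by omega)
  exact hw ▸ SimpleGraph.dist_le w

theorem dist_path (hG : G.IsTree) (hp : IsVertexPath G p) (h : i ≤ j) :
    G.dist (p i) (p j) = j - i := by
  obtain ⟨n, hn⟩ : ∃ n, (i : ℕ) + n = j := ⟨j - i, by have := Fin.le_def.1 h; omega⟩
  induction n generalizing j with
  | zero =>
    obtain rfl : i = j := Fin.ext (by simpa using hn)
    simp
  | succ n ih =>
    have hj := j.2
    let j' : Fin k := ⟨i + n, by omega⟩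
    have hij' : i ≤ j' := Fin.le_def.2 (by simp [j'])
    have hjj' : j' < j := Fin.lt_def.2 (by simp only [j']; omega)
    have hadj : G.Adj (p j') (p j) := hp.2 j' j (by simp only [j']; omega)
    have h1 := ih hij' rfl
    have hd : G.dist (p i) (p j) = G.dist (p i) (p j') + G.dist (p j') (p j) := by
      rcases hij'.eq_or_lt with he | hlt
      · simp [← he]
      · refine dist_eq_add_of_notMem_comp hG.connected fun hc => ?_
        exact disjoint_comp hG.isAcyclic hadj hc (hp.mem_comp (Or.inr ⟨hlt.trans hjj', hjj'⟩))
    rw [hd, h1, SimpleGraph.dist_eq_one_iff_adj.2 hadj]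
    simp only [j']
    omega

section Sums
open scoped Classical
variable [Fintype V]

theorem sum_comp_path (hG : G.IsTree) (hp : IsVertexPath G p) (hij : (i : ℕ) + 1 = j)
    (f : V → ℝ) : ∑ z with z ∈ comp G (p j) (p i), f z
      = ∑ l with l ≤ i, ∑ z with z ∈ attached G p l, f z := by
  rw [← Finset.sum_biUnion]
  · congr 1
    ext z
    simp [mem_comp_path_iff hG hp hij]
  · intro a _ b _ hab
    rw [Function.onFun, Finset.disjoint_left]
    intro z hz hz'
    exact hab (eq_of_mem_attached hG.isAcyclic hp (Finset.mem_filter.1 hz).2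
      (Finset.mem_filter.1 hz').2)

theorem sum_attached (hG : G.IsTree) (hp : IsVertexPath G p) (hk : 1 ≤ k)
    (f : V → ℝ) : ∑ z, f z = ∑ l, ∑ z with z ∈ attached G p l, f z := by
  rw [← Finset.sum_biUnion]
  · congr 1
    ext z
    simp [exists_mem_attached hG.connected hp hk]
  · intro a _ b _ hab
    rw [Function.onFun, Finset.disjoint_left]
    intro z hz hz'
    exact hab (eq_of_mem_attached hG.isAcyclic hp (Finset.mem_filter.1 hz).2
      (Finset.mem_filter.1 hz').2)

/-- The flow identity for an edge of the path. -/
theorem path_step (hG : G.IsTree) (hp : IsVertexPath G p) (hij : (i : ℕ) + 1 = j) {x : V → ℝ}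
    {t : ℝ} (hx : ∀ z ∈ comp G (p j) (p i), laplace G x z = t * x z) :
    x (p i) - x (p j) = t * ∑ l with l ≤ i, ∑ z with z ∈ attached G p l, x z := by
  rw [sum_comp_eigen hG (hp.2 i j hij).symm hx, sum_comp_path hG hp hij]

end Sums
end Path

/-! ### Simplicity of `a(G)`, monotonicity along the path, location of the maximum -/

section Fiedler
open scoped Classical
variable {V : Type*} [Fintype V] {G : SimpleGraph V} {k : ℕ} {p : Fin k → V} {i j l m : Fin k}
  {u v w y z : V} {x : V → ℝ} {t : ℝ}

theorem BranchCondition.posOn (hG : G.IsTree) (hp : IsVertexPath G p) (hB : BranchCondition G p)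
    (hy : y ∈ attached G p i) (hyi : y ≠ p i) : PosOn G (comp G (p i) y) (algConn G) := by
  obtain ⟨u, hu, hadj, hyu⟩ := exists_adj_of_mem_attached hG hp hy hyi
  rw [comp_eq_of_mem hyu]
  exact posOn_comp_of_lt_lambdaMin (hB i u hu hadj)

/-- The branch condition, for a spectral parameter `t`: on each attached tree without its root the
operator `L - t` is positive definite. -/
def PosBranches (G : SimpleGraph V) (p : Fin k → V) (t : ℝ) : Prop :=
  ∀ i y, y ∈ attached G p i → y ≠ p i → PosOn G (comp G (p i) y) t

theorem PosBranches.pos (hG : G.Connected) (hB : PosBranches G p t)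
    (hx : ∀ z, laplace G x z = t * x z) (hi : 0 < x (p i)) (hy : y ∈ attached G p i) : 0 < x y := by
  by_cases hyi : y = p i
  · rwa [hyi]
  · exact (hB i y hy hyi).pos hG (fun z _ => hx z) hi (self_mem_comp hyi)

theorem PosBranches.eq_zero (hB : PosBranches G p t)
    (hx : ∀ z, laplace G x z = t * x z) (hi : x (p i) = 0) (hy : y ∈ attached G p i) : x y = 0 := by
  by_cases hyi : y = p i
  · rwa [hyi]
  · exact (hB i y hy hyi).eq_zero_of_boundary (fun z _ => hx z) hi (self_mem_comp hyi)

theorem laplace_neg_eq (hx : ∀ z, laplace G x z = t * x z) (z : V) :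
    laplace G (-x) z = t * (-x) z := by
  rw [map_neg, Pi.neg_apply, hx, Pi.neg_apply]; ring

theorem PosBranches.neg (hG : G.Connected) (hB : PosBranches G p t)
    (hx : ∀ z, laplace G x z = t * x z) (hi : x (p i) < 0) (hy : y ∈ attached G p i) : x y < 0 := by
  have h := hB.pos (x := -x) hG (laplace_neg_eq hx) (by simpa using hi) hy
  simpa using h

theorem PosBranches.sum_pos (hG : G.Connected) (hp : IsVertexPath G p) (hB : PosBranches G p t)
    (hx : ∀ z, laplace G x z = t * x z) (hi : 0 < x (p i)) :
    0 < ∑ z with z ∈ attached G p i, x z :=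
  Finset.sum_pos (fun _ hz => hB.pos hG hx hi (Finset.mem_filter.1 hz).2)
    ⟨p i, by simp [self_mem_attached hp]⟩

theorem PosBranches.sum_neg (hG : G.Connected) (hp : IsVertexPath G p) (hB : PosBranches G p t)
    (hx : ∀ z, laplace G x z = t * x z) (hi : x (p i) < 0) :
    ∑ z with z ∈ attached G p i, x z < 0 :=
  Finset.sum_neg (fun _ hz => hB.neg hG hx hi (Finset.mem_filter.1 hz).2)
    ⟨p i, by simp [self_mem_attached hp]⟩

theorem PosBranches.sum_eq_zero (hB : PosBranches G p t)
    (hx : ∀ z, laplace G x z = t * x z) (hi : x (p i) = 0) :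
    ∑ z with z ∈ attached G p i, x z = 0 :=
  Finset.sum_eq_zero fun _ hz => hB.eq_zero hx hi (Finset.mem_filter.1 hz).2

/-- The eigenvector is determined by its value at the first vertex of the path. -/
theorem PosBranches.eq_zero_of_first (hG : G.IsTree) (hp : IsVertexPath G p)
    (hB : PosBranches G p t) (hx : ∀ z, laplace G x z = t * x z) (hi : (i : ℕ) = 0)
    (h0 : x (p i) = 0) : x = 0 := by
  have hall : ∀ n (j : Fin k), (j : ℕ) = n → x (p j) = 0 := by
    intro n
    induction n using Nat.strong_induction_on with
    | _ n ih =>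
      intro j hj
      rcases n with _ | n
      · rwa [show j = i from Fin.ext (by omega)]
      · let j' : Fin k := ⟨n, by have := j.2; omega⟩
        have h := path_step hG hp (i := j') (j := j) (by simp only [j']; omega) fun z _ => hx z
        rw [Finset.sum_eq_zero, mul_zero, ih n (by omega) j' rfl] at h
        · linarith
        · intro l hl
          have hl' := Fin.le_def.1 (Finset.mem_filter.1 hl).2
          exact hB.sum_eq_zero hx (ih l (by simp only [j'] at hl'; omega) l rfl)
  ext y
  obtain ⟨j, hj⟩ := exists_mem_attached hG.connected hp (by have := i.2; omega) y
  exact hB.eq_zero hx (hall j j rfl) hj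

/-- Every vector of the eigenspace is a multiple of a given Fiedler vector. -/
theorem PosBranches.exists_smul (hG : G.IsTree) (hp : IsVertexPath G p) (hk : 1 ≤ k)
    (hB : PosBranches G p (algConn G)) (hx : IsFiedlerVector G x) {f : V → ℝ}
    (hf : f ∈ fiedlerSpace G) : ∃ c : ℝ, c • x = f := by
  have h0 : x (p ⟨0, hk⟩) ≠ 0 := fun h =>
    hx.2 (hB.eq_zero_of_first hG hp hx.laplace_apply rfl h)
  refine ⟨f (p ⟨0, hk⟩) / x (p ⟨0, hk⟩), ?_⟩
  rw [← sub_eq_zero]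
  refine hB.eq_zero_of_first (i := ⟨0, hk⟩) hG hp (t := algConn G) (fun z => ?_) rfl ?_
  · have hmem := (fiedlerSpace G).sub_mem ((fiedlerSpace G).smul_mem
      (f (p ⟨0, hk⟩) / x (p ⟨0, hk⟩)) hx.1) hf
    exact congrFun (mem_fiedlerSpace_iff.1 hmem) z
  · simp [div_mul_cancel₀ _ h0]

theorem PosBranches.algConnSimple [Nontrivial V] (hG : G.IsTree) (hp : IsVertexPath G p)
    (hk : 1 ≤ k) (hB : PosBranches G p (algConn G)) : AlgConnSimple G := by
  obtain ⟨x, hx⟩ := exists_isFiedlerVector hG.connected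
  rw [AlgConnSimple, finrank_eq_one_iff_of_nonzero' (⟨x, hx.1⟩ : fiedlerSpace G)
    fun h => hx.2 (congrArg Subtype.val h)]
  rintro ⟨f, hf⟩
  obtain ⟨c, hc⟩ := hB.exists_smul hG hp hk hx hf
  exact ⟨c, Subtype.ext hc⟩

/-- A Fiedler vector `x` of a simple eigenvalue that is negative at `v` is not positive somewhere in
two different components of `G - v`: otherwise a combination of the positive parts of `x` on these
components would be orthogonal to the constants with Rayleigh quotient at most `a(G)`, hence a
Fiedler vector that vanishes at `v`. -/
theorem not_pos_on_two_components (hG : G.Connected) (hx : IsFiedlerVector G x)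
    (hsimple : ∀ f ∈ fiedlerSpace G, ∃ c : ℝ, c • x = f) (hv : x v < 0)
    (hu : 0 < x u) (hw : 0 < x w) (huw : w ∉ comp G v u) : False := by
  have huv : u ≠ v := by rintro rfl; linarith
  have hwv : w ≠ v := by rintro rfl; linarith
  have hdisj : ∀ z, z ∈ comp G v u → z ∉ comp G v w := fun z hz hz' =>
    huw (mem_comp_trans (mem_comp_symm hz') hz)
  let x₁ : V → ℝ := fun z => if z ∈ comp G v u then max (x z) 0 else 0
  let x₂ : V → ℝ := fun z => if z ∈ comp G v w then max (x z) 0 else 0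
  have hsum : ∀ u', 0 < x u' → u' ≠ v →
      0 < ∑ z, if z ∈ comp G v u' then max (x z) 0 else 0 := by
    intro u' hu' hu'v
    refine Finset.sum_pos' (fun z _ => ?_) ⟨u', Finset.mem_univ _, ?_⟩
    · split_ifs
      exacts [le_max_right _ _, le_rfl]
    · rw [if_pos (self_mem_comp hu'v)]
      exact lt_max_of_lt_left hu'
  obtain ⟨β, hβ⟩ : ∃ β, β = ∑ z, x₁ z := ⟨_, rfl⟩
  obtain ⟨α, hα⟩ : ∃ α, α = ∑ z, x₂ z := ⟨_, rfl⟩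
  have hβ0 : 0 < β := hβ ▸ hsum u hu huv
  have hα0 : 0 < α := hα ▸ hsum w hw hwv
  let f : V → ℝ := fun z => α * x₁ z - β * x₂ z
  have hfv : f v = 0 := by simp [f, x₁, x₂, notMem_comp]
  have hf₁ : ∀ z ∈ comp G v u, f z = α * max (x z) 0 := fun z hz => by
    simp [f, x₁, x₂, hz, hdisj z hz]
  have hf₂ : ∀ z ∈ comp G v w, f z = -(β * max (x z) 0) := fun z hz => by
    have : z ∉ comp G v u := fun h => hdisj z h hz
    simp [f, x₁, x₂, hz, this]
  have hf0 : ∑ z, f z = 0 := by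
    simp only [f, Finset.sum_sub_distrib, ← Finset.mul_sum, ← hα, ← hβ]
    ring
  have hpt : ∀ z, f z * laplace G f z ≤ algConn G * f z ^ 2 := by
    intro z
    by_cases h0 : f z = 0
    · simp [h0]
    by_cases hz₁ : z ∈ comp G v u
    · have hxz : 0 < x z := by
        by_contra h
        exact h0 (by rw [hf₁ z hz₁, max_eq_right (not_lt.1 h), mul_zero])
      have hfz : f z = α * x z := by rw [hf₁ z hz₁, max_eq_left hxz.le]
      have hle : laplace G f z ≤ algConn G * f z := by
        calc laplace G f z ≤ α * laplace G x z := by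
              rw [laplace_apply, laplace_apply, Finset.mul_sum]
              refine Finset.sum_le_sum fun y _ => ?_
              split_ifs with hzy
              · rw [hfz, mul_sub]
                refine sub_le_sub_left ?_ _
                by_cases hyv : y = v
                · rw [hyv, hfv]
                  exact mul_nonpos_of_nonneg_of_nonpos hα0.le hv.le
                · rw [hf₁ y (mem_comp_of_adj hz₁ hzy hyv)]
                  exact mul_le_mul_of_nonneg_left (le_max_left _ _) hα0.le
              · simp
          _ = algConn G * f z := by rw [hx.laplace_apply, hfz]; ring
      have hpos : 0 ≤ f z := by rw [hfz]; positivity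
      nlinarith [mul_le_mul_of_nonneg_left hle hpos]
    · by_cases hz₂ : z ∈ comp G v w
      · have hxz : 0 < x z := by
          by_contra h
          exact h0 (by rw [hf₂ z hz₂, max_eq_right (not_lt.1 h), mul_zero, neg_zero])
        have hfz : f z = -(β * x z) := by rw [hf₂ z hz₂, max_eq_left hxz.le]
        have hle : algConn G * f z ≤ laplace G f z := by
          calc algConn G * f z = -(β * laplace G x z) := by rw [hx.laplace_apply, hfz]; ring
            _ ≤ laplace G f z := by
              rw [laplace_apply, laplace_apply, Finset.mul_sum, ← Finset.sum_neg_distrib]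
              refine Finset.sum_le_sum fun y _ => ?_
              split_ifs with hzy
              · rw [hfz, mul_sub, neg_sub]
                have hy : f y ≤ -(β * x y) := by
                  by_cases hyv : y = v
                  · rw [hyv, hfv, neg_nonneg]
                    exact mul_nonpos_of_nonneg_of_nonpos hβ0.le hv.le
                  · rw [hf₂ y (mem_comp_of_adj hz₂ hzy hyv)]
                    exact neg_le_neg (mul_le_mul_of_nonneg_left (le_max_left _ _) hβ0.le)
                linarith
              · simp
        have hneg : f z ≤ 0 := by rw [hfz]; exact neg_nonpos.2 (by positivity)
        nlinarith [mul_le_mul_of_nonpos_left hle hneg]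
      · exact absurd (by simp [f, x₁, x₂, hz₁, hz₂]) h0
  have hmem : f ∈ fiedlerSpace G := mem_fiedlerSpace_of_le hG hf0 (by
    rw [Finset.mul_sum]
    exact Finset.sum_le_sum fun z _ => hpt z)
  obtain ⟨c, hc⟩ := hsimple f hmem
  have hcv := congrFun hc v
  rw [hfv, Pi.smul_apply, smul_eq_mul, mul_eq_zero, or_iff_left hv.ne] at hcv
  have hcu := congrFun hc u
  rw [hcv, zero_smul, Pi.zero_apply, hf₁ u (self_mem_comp huv), max_eq_left hu.le] at hcu
  exact (mul_pos hα0 hu).ne hcu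

/-- Along the path, the values of a Fiedler vector that is positive at the first vertex are
positive up to some index and nonpositive from there on. -/
theorem PosBranches.exists_sign_change [Nontrivial V] (hG : G.IsTree) (hp : IsVertexPath G p)
    (hB : PosBranches G p (algConn G)) (hx : IsFiedlerVector G x) (hi : (i : ℕ) = 0)
    (h0 : 0 < x (p i)) :
    ∃ n : ℕ, (∀ l : Fin k, (l : ℕ) < n → 0 < x (p l)) ∧ ∀ l : Fin k, n ≤ l → x (p l) ≤ 0 := by
  have hk : 1 ≤ k := by have := i.2; omega
  have hsand : ∀ m l : Fin k, m < l → x (p m) < 0 → ¬ 0 < x (p l) := by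
    intro m l hml hm hl
    have him : i < m := by
      refine Fin.lt_def.2 ?_
      by_contra h
      rw [show m = i from Fin.ext (by omega)] at hm
      linarith
    exact not_pos_on_two_components hG.connected hx (fun f hf => hB.exists_smul hG hp hk hx hf)
      hm h0 hl (hp.notMem_comp hG him hml)
  by_cases hall : ∀ l, 0 < x (p l)
  · exact ⟨k, fun l _ => hall l, fun l hl => absurd l.2 (not_lt.2 hl)⟩
  push Not at hall
  have hex : ∃ n : ℕ, ∃ h : n < k, x (p ⟨n, h⟩) ≤ 0 := by
    obtain ⟨l, hl⟩ := hall
    exact ⟨l, l.2, hl⟩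
  obtain ⟨hn, hxn⟩ := Nat.find_spec hex
  set n := Nat.find hex with hndef
  have hlt : ∀ l : Fin k, (l : ℕ) < n → 0 < x (p l) := fun l hl => by
    by_contra h
    exact Nat.find_min hex hl ⟨l.2, not_lt.1 h⟩
  refine ⟨n, hlt, fun l hl => ?_⟩
  by_contra hpos
  rw [not_le] at hpos
  have hnl : (⟨n, hn⟩ : Fin k) < l := by
    refine lt_of_le_of_ne (Fin.le_def.2 hl) ?_
    rintro rfl
    linarith
  rcases hxn.lt_or_eq with hneg | hzero
  · exact hsand _ l hnl hneg hpos
  · have h1 := Fin.lt_def.1 hnl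
    have hl2 := l.2
    simp only at h1
    let n' : Fin k := ⟨n + 1, by omega⟩
    have hstep := path_step hG hp (i := ⟨n, hn⟩) (j := n') rfl fun z _ => hx.laplace_apply z
    have hS : 0 < ∑ l with l ≤ (⟨n, hn⟩ : Fin k), ∑ z with z ∈ attached G p l, x z := by
      refine Finset.sum_pos' (fun m hm => ?_) ⟨i, ?_, ?_⟩
      · have hmn := Fin.le_def.1 (Finset.mem_filter.1 hm).2
        rcases hmn.lt_or_eq with hmn | hmn
        · exact (hB.sum_pos hG.connected hp hx.laplace_apply (hlt m hmn)).le
        · rw [show m = ⟨n, hn⟩ from Fin.ext hmn]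
          exact (hB.sum_eq_zero hx.laplace_apply hzero).ge
      · exact Finset.mem_filter.2 ⟨Finset.mem_univ _, Fin.le_def.2 (by simp only [hi]; omega)⟩
      · exact hB.sum_pos hG.connected hp hx.laplace_apply h0
    have hneg : x (p n') < 0 := by
      have := mul_pos (algConn_pos hG.connected) hS
      linarith
    refine hsand n' l (lt_of_le_of_ne (Fin.le_def.2 (by simp only [n']; omega)) ?_) hneg hpos
    intro h
    rw [h] at hneg
    linarith

/-- A Fiedler vector that is positive at the first vertex of the path decreases strictly along the
path and is negative at the last vertex. -/
theorem PosBranches.strictAnti [Nontrivial V] (hG : G.IsTree) (hp : IsVertexPath G p)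
    (hB : PosBranches G p (algConn G)) (hx : IsFiedlerVector G x) (hi : (i : ℕ) = 0)
    (hl : (l : ℕ) + 1 = k) (h0 : 0 < x (p i)) :
    StrictAnti (fun j => x (p j)) ∧ x (p l) < 0 := by
  have hk : 1 ≤ k := by omega
  have ha := algConn_pos hG.connected
  obtain ⟨n, hpos, hneg⟩ := hB.exists_sign_change hG hp hx hi h0
  let F : Fin k → ℝ := fun j => ∑ z with z ∈ attached G p j, x z
  have hFpos : ∀ j : Fin k, (j : ℕ) < n → 0 < F j := fun j hj =>
    hB.sum_pos hG.connected hp hx.laplace_apply (hpos j hj)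
  have hFneg : ∀ j : Fin k, n ≤ j → F j ≤ 0 := fun j hj => by
    rcases (hneg j hj).lt_or_eq with h | h
    · exact (hB.sum_neg hG.connected hp hx.laplace_apply h).le
    · exact (hB.sum_eq_zero hx.laplace_apply h).le
  have hn0 : 0 < n := by
    by_contra h
    exact absurd (hneg i (by omega)) (not_le.2 h0)
  have htot : ∑ j, F j = 0 := by
    rw [← sum_attached hG hp hk]
    exact hx.sum_eq_zero hG.connected
  have hsplit : ∀ j, ∑ m with m ≤ j, F m = -∑ m with ¬ m ≤ j, F m := fun j => by
    have := Finset.sum_filter_add_sum_filter_not univ (fun m => m ≤ j) F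
    linarith
  have hnl : n ≤ l := by
    by_contra h
    refine absurd htot (Finset.sum_pos (fun j _ => hFpos j ?_) ⟨i, Finset.mem_univ _⟩).ne'
    have := j.2
    omega
  have hnonneg : ∀ j, 0 ≤ ∑ m with m ≤ j, F m := by
    intro j
    rcases lt_or_ge (j : ℕ) n with hj | hj
    · exact Finset.sum_nonneg fun m hm => (hFpos m (by
        have := Fin.le_def.1 (Finset.mem_filter.1 hm).2; omega)).le
    · rw [hsplit, neg_nonneg]
      refine Finset.sum_nonpos fun m hm => hFneg m ?_
      have := Fin.lt_def.1 (not_le.1 (Finset.mem_filter.1 hm).2)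
      omega
  have hstep : ∀ a b : Fin k, (a : ℕ) + 1 = b →
      x (p a) - x (p b) = algConn G * ∑ m with m ≤ a, F m := fun a b hab =>
    path_step hG hp hab fun z _ => hx.laplace_apply z
  have hlast : x (p l) < 0 := by
    refine lt_of_le_of_ne (hneg l hnl) fun hl0 => ?_
    -- By monotonicity all values would be nonnegative, contradicting that they sum to zero.
    have hge : ∀ d : ℕ, ∀ j : Fin k, (j : ℕ) + d = l → 0 ≤ x (p j) := by
      intro d
      induction d with
      | zero =>
        intro j hj
        rw [show j = l from Fin.ext (by omega), hl0]
      | succ d ih =>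
        intro j hj
        have := l.2
        have h1 := ih ⟨j + 1, by omega⟩ (by simp only; omega)
        have h2 := hstep j ⟨j + 1, by omega⟩ rfl
        have h3 := mul_nonneg ha.le (hnonneg j)
        linarith
    refine absurd htot (Finset.sum_pos' (fun j _ => ?_) ⟨i, Finset.mem_univ _,
      hFpos i (by omega)⟩).ne'
    rcases (hge (l - j) j (by have := j.2; omega)).lt_or_eq with h | h
    · exact (hB.sum_pos hG.connected hp hx.laplace_apply h).le
    · exact (hB.sum_eq_zero hx.laplace_apply h.symm).ge
  refine ⟨?_, hlast⟩
  have hposF : ∀ j : Fin k, j < l → 0 < ∑ m with m ≤ j, F m := by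
    intro j hjl
    rcases lt_or_ge (j : ℕ) n with hj | hj
    · refine Finset.sum_pos (fun m hm => hFpos m ?_) ⟨j, by simp⟩
      have := Fin.le_def.1 (Finset.mem_filter.1 hm).2; omega
    · rw [hsplit, neg_pos]
      refine Finset.sum_neg' (fun m hm => hFneg m ?_) ⟨l, by simpa using hjl,
        hB.sum_neg hG.connected hp hx.laplace_apply hlast⟩
      have := Fin.lt_def.1 (not_le.1 (Finset.mem_filter.1 hm).2)
      omega
  have hlt : ∀ d : ℕ, ∀ a b : Fin k, (a : ℕ) + d + 1 = b → x (p b) < x (p a) := by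
    intro d
    induction d with
    | zero =>
      intro a b hab
      have h := hstep a b (by omega)
      have := mul_pos ha (hposF a (Fin.lt_def.2 (by have := b.2; omega)))
      linarith
    | succ d ih =>
      intro a b hab
      have hb := b.2
      let b' : Fin k := ⟨a + d + 1, by omega⟩
      have hb' : (b' : ℕ) = a + d + 1 := rfl
      have h1 := ih a b' hb'.symm
      have h := hstep b' b (by omega)
      have := mul_pos ha (hposF b' (Fin.lt_def.2 (by omega)))
      linarith
  intro a b hab
  have := Fin.lt_def.1 hab
  exact hlt (b - a - 1) a b (by omega)

/-- Where it is positive, an eigenvector increases on the attached trees in the direction away from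
the path. -/
theorem PosBranches.lt_of_adj (hG : G.IsTree) (hp : IsVertexPath G p) (hB : PosBranches G p t)
    (ht : 0 < t) (hx : ∀ z, laplace G x z = t * x z) (hi : 0 < x (p i)) (hu : u ∈ attached G p i)
    (hyu : G.Adj y u) (hiy : p i ∉ comp G y u) : x y < x u := by
  have h := sum_comp_eigen hG hyu fun z _ => hx z
  have hpos : 0 < ∑ z with z ∈ comp G y u, x z :=
    Finset.sum_pos (fun z hz => hB.pos hG.connected hx hi
      (comp_subset_attached hG.isAcyclic hp hu hiy (Finset.mem_filter.1 hz).2).1)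
      ⟨u, by simp [self_mem_comp hyu.ne']⟩
  have := mul_pos ht hpos
  linarith

theorem PosBranches.ratioFn_mul (hG : G.IsTree) (hp : IsVertexPath G p) (hB : PosBranches G p t)
    (hx : ∀ z, laplace G x z = t * x z) (hy : IsPendantOf G p i y) :
    ratioFn G y (p i) t * x y = x (p i) := by
  obtain ⟨h1, h2, h3⟩ := (isPendantOf_iff hG.isAcyclic hp).1 hy
  exact GenCaterpillar.ratioFn_mul hG.connected h2 h3 (hB i y h1 h2) fun z _ => hx z

/-- The maximum of an eigenvector with dominant positive value at `p i` is attained at the pendant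
vertex `w` of the tree attached at `p i` for which the ratio function is smallest. -/
theorem PosBranches.maximum (hG : G.IsTree) (hp : IsVertexPath G p) (hB : PosBranches G p t)
    (ht : 0 < t) (hx : ∀ z, laplace G x z = t * x z) (hi : 0 < x (p i)) (hj : x (p j) < 0)
    (hmax : ∀ l, l ≠ i → x (p l) < x (p i)) (hw : IsPendantOf G p i w)
    (hg : 0 < ratioFn G w (p i) t)
    (hle : ∀ l y, l ≠ j → IsPendantOf G p l y → ratioFn G w (p i) t ≤ ratioFn G y (p l) t) :
    (∀ s, x s ≤ x w) ∧ 0 < x w ∧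
      ((∀ y, IsPendantOf G p i y → ratioFn G y (p i) t = ratioFn G w (p i) t → y = w) →
        ∀ s, s ≠ w → x s < x w) := by
  have hk : 1 ≤ k := by have := i.2; omega
  have hwi := (isPendantOf_iff hG.isAcyclic hp).1 hw
  have hwx := hB.ratioFn_mul hG hp hx hw
  have hw0 : 0 < x w := hB.pos hG.connected hx hi hwi.1
  have main : ∀ y, (∀ s, x s ≤ x y) → x y ≤ x w ∧
      ((∀ y, IsPendantOf G p i y → ratioFn G y (p i) t = ratioFn G w (p i) t → y = w) →
        y = w) := by
    intro y hy
    obtain ⟨l, hl⟩ := exists_mem_attached hG.connected hp hk y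
    have hypos : 0 < x y := hi.trans_le (hy _)
    have hlpos : 0 < x (p l) := by
      rcases lt_trichotomy (x (p l)) 0 with h | h | h
      · exact absurd (hB.neg hG.connected hx h hl) hypos.not_gt
      · exact absurd (hB.eq_zero hx h hl) hypos.ne'
      · exact h
    have hlj : l ≠ j := by rintro rfl; linarith
    by_cases hyl : y = p l
    · exfalso
      by_cases hli : l = i
      · subst hli
        obtain ⟨u, hu, hadj, -⟩ := exists_adj_of_mem_attached hG hp hwi.1 hwi.2.1
        have := hB.lt_of_adj hG hp ht hx hi hu hadj GenCaterpillar.notMem_comp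
        exact absurd (hy u) (not_le.2 (hyl ▸ this))
      · exact absurd (hy (p i)) (not_le.2 (hyl ▸ hmax l hli))
    · have hdeg : (G.neighborSet y).ncard = 1 := by
        by_contra hdeg
        obtain ⟨n, hn, hc⟩ := exists_adj_notMem_comp hG hyl hdeg
        have := hB.lt_of_adj hG hp ht hx hlpos
          (mem_attached_of_adj_of_ne hG.isAcyclic hp hl hyl hn) hn hc
        exact absurd (hy n) (not_le.2 this)
      have hpend : IsPendantOf G p l y := (isPendantOf_iff hG.isAcyclic hp).2 ⟨hl, hyl, hdeg⟩
      have hyx := hB.ratioFn_mul hG hp hx hpend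
      have hgle := mul_le_mul_of_nonneg_right (hle l y hlj hpend) hypos.le
      rw [hyx] at hgle
      by_cases hli : l = i
      · subst hli
        have h1 : x y ≤ x w := le_of_mul_le_mul_left (hgle.trans_eq hwx.symm) hg
        refine ⟨h1, fun huniq => huniq y hpend ?_⟩
        have h2 : x y = x w := le_antisymm h1 (hy w)
        rw [h2, ← hwx] at hyx
        exact mul_right_cancel₀ hw0.ne' hyx
      · have h1 : x y < x w :=
          lt_of_mul_lt_mul_left ((hgle.trans_lt (hmax l hli)).trans_eq hwx.symm) hg.le
        exact absurd (hy w) (not_le.2 h1)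
  have : Nonempty V := ⟨w⟩
  obtain ⟨y, hy⟩ := Finite.exists_max x
  have hall : ∀ s, x s ≤ x w := fun s => (hy s).trans (main y hy).1
  refine ⟨hall, hw0, fun huniq s hs => lt_of_le_of_ne (hall s) fun hsw => hs ?_⟩
  exact (main s fun s' => hsw ▸ hall s').2 huniq

end Fiedler

/-! ### Depth of the attached trees and longest paths -/

section Depth
variable {V : Type*} {G : SimpleGraph V} {c v : V}

theorem exists_vertexPath_dist (hG : G.Connected) (v c : V) :
    ∃ q : ℕ → V, IsVertexPath G (fun l : Fin (G.dist v c + 1) => q l) ∧ q 0 = v ∧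
      q (G.dist v c) = c := by
  obtain ⟨w, hw, hd⟩ := hG.exists_path_of_dist v c
  refine ⟨w.getVert, ⟨fun a b hab => ?_, fun a b hab => ?_⟩, by simp, by simp [← hd]⟩
  · refine Fin.ext (hw.getVert_injOn ?_ ?_ hab)
    · have := a.2; simp only [Set.mem_ofPred_eq]; omega
    · have := b.2; simp only [Set.mem_ofPred_eq]; omega
  · have := b.2
    simp only [← hab]
    exact w.adj_getVert_succ (by omega)

variable {d : ℕ} {q : Fin (d + 1) → V} {i j m : Fin (d + 1)} {z : V}

theorem comp_path_subset (hG : G.IsTree) (hq : IsVertexPath G q) (hij : (i : ℕ) + 1 = j) :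
    comp G (q j) (q i) ⊆ comp G (q (Fin.last d)) (q 0) := by
  have hj := j.2
  refine (comp_subset (c' := q (Fin.last d)) fun h => ?_).trans fun z hz => mem_comp_trans hz ?_
  · obtain ⟨l, hl, hlast⟩ := (mem_comp_path_iff hG hq hij).1 h
    have := eq_of_path_mem_attached hG.isAcyclic hq hlast
    subst this
    have := Fin.le_def.1 hl
    simp only [Fin.val_last] at this
    omega
  · refine hq.mem_comp (Or.inr ⟨?_, ?_⟩) <;> rw [Fin.lt_def] <;> simp <;> omega

theorem attached_path_subset (hG : G.IsTree) (hq : IsVertexPath G q) (hi : (i : ℕ) < d) :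
    attached G q i ⊆ comp G (q (Fin.last d)) (q 0) := fun _ hz =>
  comp_path_subset hG hq (i := i) (j := ⟨i + 1, by omega⟩) rfl
    ((mem_comp_path_iff hG hq rfl).2 ⟨i, le_rfl, hz⟩)

open scoped Classical in
theorem path_step_zero [Fintype V] (hG : G.IsTree) (hq : IsVertexPath G q) (hi : (i : ℕ) = 0)
    (hj : (j : ℕ) = 1) {x : V → ℝ} {t : ℝ}
    (hx : ∀ z ∈ comp G (q (Fin.last d)) (q 0), laplace G x z = t * x z) :
    x (q i) - x (q j) = t * ∑ z with z ∈ attached G q i, x z := by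
  rw [path_step hG hq (by omega) fun z hz => hx z (comp_path_subset hG hq (by omega) hz)]
  congr 1
  have : univ.filter (fun l => l ≤ i) = {i} := by
    ext l
    simp only [Finset.mem_filter, Finset.mem_univ, true_and, Finset.mem_singleton, Fin.le_def,
      Fin.ext_iff]
    omega
  rw [this, Finset.sum_singleton]

open scoped Classical in
/-- The increments along a path differ by `t` times the sum over the tree attached in between. -/
theorem path_step_succ [Fintype V] (hG : G.IsTree) (hq : IsVertexPath G q) (hij : (i : ℕ) + 1 = j)
    (hjm : (j : ℕ) + 1 = m) {x : V → ℝ} {t : ℝ}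
    (hx : ∀ z ∈ comp G (q (Fin.last d)) (q 0), laplace G x z = t * x z) :
    x (q j) - x (q m) = x (q i) - x (q j) + t * ∑ z with z ∈ attached G q j, x z := by
  rw [path_step hG hq hij fun z hz => hx z (comp_path_subset hG hq hij hz),
    path_step hG hq hjm fun z hz => hx z (comp_path_subset hG hq hjm hz), ← mul_add]
  congr 1
  have : univ.filter (fun l => l ≤ j) = insert j (univ.filter (fun l => l ≤ i)) := by
    ext l
    simp only [Finset.mem_filter, Finset.mem_univ, true_and, Finset.mem_insert, Fin.le_def,
      Fin.ext_iff]
    omega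
  rw [this, Finset.sum_insert, add_comm]
  simp only [Finset.mem_filter, Finset.mem_univ, true_and, Fin.le_def]
  omega

/-- Discrete Sturm comparison: `β` satisfies a three-term recurrence of which `α` is a
subsolution, so the quotients `α (n + 1) / α n` are at most `β (n + 1) / β n`, and `α` decays
more. -/
theorem sturm_comparison {α β : ℕ → ℝ} {t : ℝ} {d ℓ : ℕ} (ht : 0 < t) (hℓd : ℓ < d) (hℓ : 0 < ℓ)
    (hα : ∀ n ≤ d, 0 < α n) (hβ : ∀ n ≤ ℓ, 0 < β n)
    (hα0 : t * α 0 ≤ α 0 - α 1) (hβ0 : β 0 - β 1 = t * β 0)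
    (hα1 : ∀ n, n + 2 ≤ d → α n - α (n + 1) + t * α (n + 1) ≤ α (n + 1) - α (n + 2))
    (hβ1 : ∀ n, n + 2 ≤ ℓ → β (n + 1) - β (n + 2) = β n - β (n + 1) + t * β (n + 1)) :
    α d * β 0 < α 0 * β ℓ := by
  -- The discrete Wronskian of the two sequences has a constant sign.
  have hW : ∀ n, n + 1 ≤ ℓ → α (n + 1) * β n ≤ α n * β (n + 1) := by
    intro n
    induction n with
    | zero =>
      intro _
      have h1 := hα 0 (by omega)
      have h2 := hβ 0 (by omega)
      nlinarith [mul_le_mul_of_nonneg_right hα0 h2.le]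
    | succ n ih =>
      intro hn
      have h0 := ih (by omega)
      have h1 := mul_le_mul_of_nonneg_right (hα1 n (by omega)) (hβ (n + 1) (by omega)).le
      have h2 := congrArg (fun s => α (n + 1) * s) (hβ1 n (by omega))
      nlinarith
  have hR : ∀ n ≤ ℓ, α n * β 0 ≤ α 0 * β n := by
    intro n
    induction n with
    | zero => intro _; exact le_rfl
    | succ n ih =>
      intro hn
      have h0 := ih (by omega)
      have h1 := hW n hn
      have hn0 := hβ n (by omega)
      refine le_of_mul_le_mul_right ?_ hn0
      calc α (n + 1) * β 0 * β n = α (n + 1) * β n * β 0 := by ring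
        _ ≤ α n * β (n + 1) * β 0 := mul_le_mul_of_nonneg_right h1 (hβ 0 (by omega)).le
        _ = α n * β 0 * β (n + 1) := by ring
        _ ≤ α 0 * β n * β (n + 1) := mul_le_mul_of_nonneg_right h0 (hβ _ hn).le
        _ = α 0 * β (n + 1) * β n := by ring
  have hdec : ∀ n, n + 1 ≤ d → α (n + 1) < α n := by
    intro n
    induction n with
    | zero =>
      intro _
      have := mul_pos ht (hα 0 (by omega))
      linarith
    | succ n ih =>
      intro hn
      have h1 := ih (by omega)
      have h2 := hα1 n (by omega)
      have := mul_pos ht (hα (n + 1) (by omega))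
      linarith
  have hlt : ∀ e, ℓ + e + 1 ≤ d → α (ℓ + e + 1) < α ℓ := by
    intro e
    induction e with
    | zero => exact fun h => hdec _ h
    | succ e ih => exact fun h => (hdec _ h).trans (ih (by omega))
  have hd : α d < α ℓ := by
    have := hlt (d - ℓ - 1) (by omega)
    rwa [show ℓ + (d - ℓ - 1) + 1 = d by omega] at this
  exact (mul_lt_mul_of_pos_right hd (hβ 0 (by omega))).trans_le (hR ℓ le_rfl)

end Depth

section UniquePendant
variable {V : Type*} [Fintype V] {G : SimpleGraph V} {k : ℕ} {p : Fin k → V} {i j : Fin k}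
  {s v w y z : V} {t : ℝ}

/-- If `w` is the only pendant vertex of an attached tree, this tree is the path from `w` to its
root: nothing else is attached to the inner vertices of that path. -/
theorem attached_eq_singleton (hG : G.IsTree) (hp : IsVertexPath G p) (hw : IsPendantOf G p i w)
    (huniq : ∀ y, IsPendantOf G p i y → y = w) {d : ℕ} {q : Fin (d + 1) → V}
    (hq : IsVertexPath G q) (h0 : q 0 = w) (hlast : q (Fin.last d) = p i) {l : Fin (d + 1)}
    (hl : (l : ℕ) < d) : attached G q l = {q l} := by
  refine Set.Subset.antisymm (fun y hy => ?_)
    (Set.singleton_subset_iff.2 (self_mem_attached hq l))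
  by_contra hyl
  obtain ⟨u, hu, hadj, -⟩ := exists_adj_of_mem_attached hG hq hy hyl
  have hsub := comp_subset_attached hG.isAcyclic hq hu notMem_comp
  have hllast : l ≠ Fin.last d := fun h => by simp [h] at hl
  have hpi : p i ∉ comp G (q l) u := fun h => by
    rw [← hlast] at h
    exact hllast (eq_of_path_mem_attached hG.isAcyclic hq (hsub h).1).symm
  obtain ⟨v, hv, hv1⟩ := exists_leaf_mem_comp hG hadj
  have hql : q l ∈ attached G p i := by
    have h1 := attached_path_subset hG hq hl (self_mem_attached hq l)
    rw [hlast, h0] at h1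
    exact (comp_subset_attached hG.isAcyclic hp hw.1 notMem_comp h1).1
  have hqne : q l ≠ p i := fun h => hllast (hq.1 (h.trans hlast.symm))
  have hua := mem_attached_of_adj_of_ne hG.isAcyclic hp hql hqne hadj
  have hva := comp_subset_attached hG.isAcyclic hp hua hpi hv
  have hvw := huniq v ((isPendantOf_iff hG.isAcyclic hp).2 ⟨hva.1, hva.2, hv1⟩)
  have h2 := hsub hv
  rw [hvw, ← h0] at h2
  have := eq_of_path_mem_attached hG.isAcyclic hq h2.1
  rw [this] at h2
  exact h2.2 rfl

theorem mem_path_of_uniquePendant (hG : G.IsTree) (hp : IsVertexPath G p)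
    (huniq : ∀ y, IsPendantOf G p i y → y = w)
    {q : ℕ → V} (hlast : q (G.dist w (p i)) = p i) (h0 : q 0 = w)
    (hs : s ∈ attached G p i)
    (hq : IsVertexPath G (fun l : Fin (G.dist w (p i) + 1) => q l)) :
    ∃ n ≤ G.dist w (p i), s = q n := by
  by_cases hsi : s = p i
  · exact ⟨_, le_rfl, hsi.trans hlast.symm⟩
  obtain ⟨v, hv, h⟩ := exists_pendant_beyond hG hp hs hsi
  obtain rfl := huniq v hv
  rcases h with rfl | h
  · exact ⟨0, Nat.zero_le _, h0.symm⟩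
  obtain ⟨W, -, hW⟩ := hq.exists_walk (i := 0) (j := Fin.last _) (G.dist v (p i)) (by simp)
  have hsW : s ∈ W.support := by
    by_contra hsW
    refine h ?_
    have : q 0 ∈ comp G s (q (G.dist v (p i))) := ⟨W, hsW⟩
    rwa [h0, hlast] at this
  obtain ⟨l, -, -, hl⟩ := hW s hsW
  exact ⟨l, by have := l.2; omega, hl⟩

theorem dist_le_of_uniquePendant (hG : G.IsTree) (hp : IsVertexPath G p)
    (huniq : ∀ y, IsPendantOf G p i y → y = w) {s s' : V}
    (hs : s ∈ attached G p i) (hs' : s' ∈ attached G p i) : G.dist s s' ≤ G.dist w (p i) := by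
  obtain ⟨q, hq, h0, hlast⟩ := exists_vertexPath_dist hG.connected w (p i)
  obtain ⟨n, hn, rfl⟩ := mem_path_of_uniquePendant hG hp huniq hlast h0 hs hq
  obtain ⟨n', hn', rfl⟩ := mem_path_of_uniquePendant hG hp huniq hlast h0 hs' hq
  wlog h : n ≤ n' generalizing n n'
  · rw [SimpleGraph.dist_comm]
    exact this n' hn' hs' n hn hs (by omega)
  have := dist_path_le hq (i := ⟨n, by omega⟩) (j := ⟨n', by omega⟩) h
  simp only at this
  omega

open scoped Classical in
/-- If `w` is the only pendant vertex of an attached tree and its ratio function is at most that of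
`v`, then `v` has at most the depth of `w`: the values along the path from `w` decay as slowly as
possible. -/
theorem PosBranches.dist_le (hG : G.IsTree) (hp : IsVertexPath G p) (hB : PosBranches G p t)
    (ht : 0 < t) (hw : IsPendantOf G p i w) (huniq : ∀ y, IsPendantOf G p i y → y = w)
    (hv : IsPendantOf G p j v) (hle : ratioFn G w (p i) t ≤ ratioFn G v (p j) t) :
    G.dist v (p j) ≤ G.dist w (p i) := by
  by_contra hlt
  rw [not_le] at hlt
  obtain ⟨hv1, hv2, hv3⟩ := (isPendantOf_iff hG.isAcyclic hp).1 hv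
  obtain ⟨hw1, hw2, hw3⟩ := (isPendantOf_iff hG.isAcyclic hp).1 hw
  obtain ⟨x, hx0, hx⟩ := (hB j v hv1 hv2).exists_solution fun _ => 1
  obtain ⟨y, hy0, hy⟩ := (hB i w hw1 hw2).exists_solution fun _ => 1
  have hxc := hx0 _ GenCaterpillar.notMem_comp
  have hyc := hy0 _ GenCaterpillar.notMem_comp
  have hxpos : ∀ z ∈ comp G (p j) v, 0 < x z := fun z hz =>
    (hB j v hv1 hv2).pos hG.connected hx (hxc ▸ one_pos) hz
  have hypos : ∀ z ∈ comp G (p i) w, 0 < y z := fun z hz =>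
    (hB i w hw1 hw2).pos hG.connected hy (hyc ▸ one_pos) hz
  have hxr := GenCaterpillar.ratioFn_mul hG.connected hv2 hv3 (hB j v hv1 hv2) hx
  have hyr := GenCaterpillar.ratioFn_mul hG.connected hw2 hw3 (hB i w hw1 hw2) hy
  rw [hxc] at hxr
  rw [hyc] at hyr
  obtain ⟨a, ha, ha0, had⟩ := exists_vertexPath_dist hG.connected v (p j)
  obtain ⟨b, hb, hb0, hbd⟩ := exists_vertexPath_dist hG.connected w (p i)
  have hℓ : 0 < G.dist w (p i) := hG.connected.pos_dist_of_ne hw2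
  generalize G.dist v (p j) = d at *
  generalize G.dist w (p i) = ℓ at *
  have hx' : ∀ z ∈ comp G (a (Fin.last d)) (a (0 : Fin (d + 1))), laplace G x z = t * x z := by
    simpa [ha0, had] using hx
  have hy' : ∀ z ∈ comp G (b (Fin.last ℓ)) (b (0 : Fin (ℓ + 1))), laplace G y z = t * y z := by
    simpa [hb0, hbd] using hy
  have hxle : ∀ n (hn : n < d), x (a n) ≤
      ∑ z with z ∈ attached G (fun l : Fin (d + 1) => a l) ⟨n, by omega⟩, x z := by
    intro n hn
    have hsub := attached_path_subset hG ha (i := ⟨n, by omega⟩) hn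
    simp only [Fin.val_last, had, Fin.val_zero, ha0] at hsub
    refine Finset.single_le_sum (f := x)
      (fun z hz => (hxpos z (hsub (Finset.mem_filter.1 hz).2)).le) ?_
    exact Finset.mem_filter.2 ⟨Finset.mem_univ _, self_mem_attached ha ⟨n, by omega⟩⟩
  have hyeq : ∀ n (hn : n < ℓ),
      ∑ z with z ∈ attached G (fun l : Fin (ℓ + 1) => b l) ⟨n, by omega⟩, y z = y (b n) := by
    intro n hn
    rw [attached_eq_singleton hG hp hw huniq hb (by simpa using hb0) (by simpa using hbd) hn]
    exact Finset.sum_eq_single_of_mem (b n) (by simp) fun z hz hne => absurd (by simpa using hz) hne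
  have key := sturm_comparison (α := fun n => x (a n)) (β := fun n => y (b n)) ht hlt hℓ
    (fun n hn => by
      rcases hn.lt_or_eq with hn | rfl
      · have hsub := attached_path_subset hG ha (i := ⟨n, by omega⟩) hn
        simp only [Fin.val_last, had, Fin.val_zero, ha0] at hsub
        exact hxpos _ (hsub (self_mem_attached ha ⟨n, by omega⟩))
      · simp only [had, hxc]; exact one_pos)
    (fun n hn => by
      rcases hn.lt_or_eq with hn | rfl
      · have hsub := attached_path_subset hG hb (i := ⟨n, by omega⟩) hn
        simp only [Fin.val_last, hbd, Fin.val_zero, hb0] at hsub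
        exact hypos _ (hsub (self_mem_attached hb ⟨n, by omega⟩))
      · simp only [hbd, hyc]; exact one_pos)
    (by
      have h := path_step_zero hG ha (i := ⟨0, by omega⟩) (j := ⟨1, by omega⟩) rfl rfl hx'
      have h2 := mul_le_mul_of_nonneg_left (hxle 0 (by omega)) ht.le
      simp only at h ⊢
      linarith)
    (by
      have h := path_step_zero hG hb (i := ⟨0, by omega⟩) (j := ⟨1, by omega⟩) rfl rfl hy'
      rwa [hyeq 0 hℓ] at h)
    (fun n hn => by
      have h := path_step_succ hG ha (i := ⟨n, by omega⟩) (j := ⟨n + 1, by omega⟩)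
        (m := ⟨n + 2, by omega⟩) rfl rfl hx'
      have h2 := mul_le_mul_of_nonneg_left (hxle (n + 1) (by omega)) ht.le
      simp only at h ⊢
      linarith)
    (fun n hn => by
      have h := path_step_succ hG hb (i := ⟨n, by omega⟩) (j := ⟨n + 1, by omega⟩)
        (m := ⟨n + 2, by omega⟩) rfl rfl hy'
      rwa [hyeq (n + 1) (by omega)] at h)
  simp only [had, hbd, hxc, hyc, ha0, hb0, one_mul, mul_one] at key
  have hv0 : 0 < x v := hxpos v (self_mem_comp hv2)
  have hw0 : 0 < y w := hypos w (self_mem_comp hw2)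
  have hgw : 0 < ratioFn G w (p i) t := by
    by_contra h
    have := mul_nonpos_of_nonpos_of_nonneg (not_lt.1 h) hw0.le
    linarith
  have h1 := mul_lt_mul_of_pos_left key hgw
  have h2 := mul_le_mul_of_nonneg_right hle hv0.le
  linarith

/-- If the two end trees have a single pendant vertex each, with ratio functions that are minimal in
the sense of the hypotheses, these pendant vertices are the endpoints of a longest path. -/
theorem PosBranches.endsOfLongestPath (hG : G.IsTree) (hp : IsVertexPath G p)
    (hB : PosBranches G p t) (ht : 0 < t) (hi : (i : ℕ) = 0) (hj : (j : ℕ) + 1 = k) (hk : 2 ≤ k)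
    {w₁ w₂ : V} (hw₁ : IsPendantOf G p i w₁) (hw₂ : IsPendantOf G p j w₂)
    (h₁ : ∀ l y, l ≠ j → IsPendantOf G p l y → ratioFn G w₁ (p i) t ≤ ratioFn G y (p l) t)
    (h₂ : ∀ l y, l ≠ i → IsPendantOf G p l y → ratioFn G w₂ (p j) t ≤ ratioFn G y (p l) t)
    (hu₁ : ∀ y, IsPendantOf G p i y → y = w₁) (hu₂ : ∀ y, IsPendantOf G p j y → y = w₂) :
    EndsOfLongestPath G w₁ w₂ := by
  have hij : i ≠ j := by rintro rfl; omega
  -- The depth of the attached trees.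
  have hdepth : ∀ (l : Fin k) (m : Fin k) (w : V), IsPendantOf G p m w →
      (∀ y, IsPendantOf G p m y → y = w) →
      (∀ y, IsPendantOf G p l y → ratioFn G w (p m) t ≤ ratioFn G y (p l) t) →
      ∀ s ∈ attached G p l, G.dist s (p l) ≤ G.dist w (p m) := by
    intro l m w hw hu hle s hs
    by_cases hsl : s = p l
    · simp [hsl]
    obtain ⟨v, hv, h⟩ := exists_pendant_beyond hG hp hs hsl
    refine le_trans ?_ (hB.dist_le hG hp ht hw hu hv (hle v hv))
    rcases h with rfl | h
    · exact le_rfl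
    · rw [dist_eq_add_of_notMem_comp hG.connected h]
      exact Nat.le_add_left _ _
  have hd₁ : ∀ l, l ≠ j → ∀ s ∈ attached G p l, G.dist s (p l) ≤ G.dist w₁ (p i) :=
    fun l hl => hdepth l i w₁ hw₁ hu₁ fun y => h₁ l y hl
  have hd₂ : ∀ l, l ≠ i → ∀ s ∈ attached G p l, G.dist s (p l) ≤ G.dist w₂ (p j) :=
    fun l hl => hdepth l j w₂ hw₂ hu₂ fun y => h₂ l y hl
  -- The distance of the two pendant vertices.
  have hcut : ∀ (l m : Fin k) (a b : V), l ≠ m → a ∈ attached G p l → b ∈ attached G p m →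
      b ∉ comp G (p l) a := by
    intro l m a b hlm ha hb h
    exact hlm (eq_of_mem_attached hG.isAcyclic hp
      (comp_subset_attached hG.isAcyclic hp ha GenCaterpillar.notMem_comp h).1 hb)
  have htot : G.dist w₁ w₂ = G.dist w₁ (p i) + (k - 1) + G.dist w₂ (p j) := by
    have e1 : G.dist w₂ w₁ = G.dist w₂ (p i) + G.dist (p i) w₁ :=
      dist_eq_add_of_notMem_comp hG.connected (hcut i j w₁ w₂ hij hw₁.1 hw₂.1)
    have e2 : G.dist (p i) w₂ = G.dist (p i) (p j) + G.dist (p j) w₂ :=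
      dist_eq_add_of_notMem_comp hG.connected
        (hcut j i w₂ (p i) hij.symm hw₂.1 (self_mem_attached hp i))
    rw [dist_path hG hp (Fin.le_def.2 (by omega))] at e2
    rw [SimpleGraph.dist_comm, e1, SimpleGraph.dist_comm (u := w₂), e2,
      SimpleGraph.dist_comm (u := p i) (v := w₁), SimpleGraph.dist_comm (u := p j)]
    omega
  have hmain : ∀ (l m : Fin k) (s r : V), l ≤ m → s ∈ attached G p l → r ∈ attached G p m →
      G.dist s r ≤ G.dist w₁ w₂ := by
    intro l m s r hlm hs hr
    have htri := hG.connected.dist_triangle (u := s) (v := p l) (w := r)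
    have htri2 := hG.connected.dist_triangle (u := p l) (v := p m) (w := r)
    have hle := dist_path_le hp hlm
    have hlm' := Fin.le_def.1 hlm
    have hm := m.2
    rw [SimpleGraph.dist_comm (u := p m)] at htri2
    by_cases hlj : l = j
    · have hmj : m = j := Fin.ext (by rw [hlj] at hlm'; omega)
      subst hlj
      subst hmj
      have := dist_le_of_uniquePendant hG hp hu₂ hs hr
      omega
    · have a1 := hd₁ l hlj s hs
      by_cases hmi : m = i
      · have hli : l = i := Fin.ext (by rw [hmi] at hlm'; omega)
        subst hmi
        subst hli
        have := dist_le_of_uniquePendant hG hp hu₁ hs hr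
        omega
      · have a2 := hd₂ m hmi r hr
        omega
  intro s r
  obtain ⟨l, hl⟩ := exists_mem_attached hG.connected hp (by omega) s
  obtain ⟨m, hm⟩ := exists_mem_attached hG.connected hp (by omega) r
  rcases le_total l m with h | h
  · exact hmain l m s r h hl hm
  · rw [SimpleGraph.dist_comm]
    exact hmain m l r s h hm hl

end UniquePendant

/-! ### The extrema of a Fiedler vector -/

section FED
variable {V : Type*} {G : SimpleGraph V} {k : ℕ} {p : Fin k → V} {i j : Fin k} {w₁ w₂ : V}

theorem onlyExtrema_or {x : V → ℝ} {y z y' z' : V} (h : OnlyExtrema x y z)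
    (h' : OnlyExtrema x y' z') : (y = y' ∧ z = z') ∨ (y = z' ∧ z = y') := by
  have hmax : ∀ a b, (∀ s, s ≠ a → x s < x a) → (∀ s, s ≠ b → x s < x b) → a = b :=
    fun a b ha hb => by
      by_contra hne
      exact lt_asymm (ha b (Ne.symm hne)) (hb a hne)
  have hmin : ∀ a b, (∀ s, s ≠ a → x a < x s) → (∀ s, s ≠ b → x b < x s) → a = b :=
    fun a b ha hb => by
      by_contra hne
      exact lt_asymm (ha b (Ne.symm hne)) (hb a hne)
  rcases h with ⟨h1, h2⟩ | ⟨h1, h2⟩ <;> rcases h' with ⟨h3, h4⟩ | ⟨h3, h4⟩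
  · exact Or.inl ⟨hmax _ _ h1 h3, hmin _ _ h2 h4⟩
  · exact Or.inr ⟨hmax _ _ h1 h3, hmin _ _ h2 h4⟩
  · exact Or.inr ⟨hmin _ _ h2 h4, hmax _ _ h1 h3⟩
  · exact Or.inl ⟨hmin _ _ h2 h4, hmax _ _ h1 h3⟩

variable [Fintype V]

theorem IsFiedlerVector.neg {x : V → ℝ} (hx : IsFiedlerVector G x) : IsFiedlerVector G (-x) :=
  ⟨(fiedlerSpace G).neg_mem hx.1, neg_ne_zero.2 hx.2⟩

variable [Nontrivial V]

/-- The extrema of a Fiedler vector that is positive at the first path vertex: its maximum is at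
`w₁`, and, by the same argument for `-x` from the other end, its minimum at `w₂`. -/
theorem ratioFn_extrema (hG : G.IsTree) (hp : IsVertexPath G p)
    (hB : PosBranches G p (algConn G)) (hi : (i : ℕ) = 0) (hj : (j : ℕ) + 1 = k)
    (hw₁ : IsPendantOf G p i w₁) (hw₂ : IsPendantOf G p j w₂)
    (hg₁ : 0 < ratioFn G w₁ (p i) (algConn G)) (hg₂ : 0 < ratioFn G w₂ (p j) (algConn G))
    (h₁ : ∀ l y, l ≠ j → IsPendantOf G p l y →
      ratioFn G w₁ (p i) (algConn G) ≤ ratioFn G y (p l) (algConn G))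
    (h₂ : ∀ l y, l ≠ i → IsPendantOf G p l y →
      ratioFn G w₂ (p j) (algConn G) ≤ ratioFn G y (p l) (algConn G))
    {x : V → ℝ} (hx : IsFiedlerVector G x) (hpos : 0 < x (p i)) :
    (x w₂ < 0 ∧ 0 < x w₁ ∧ ∀ s, x w₂ ≤ x s ∧ x s ≤ x w₁) ∧
    ((∀ y, IsPendantOf G p i y →
        ratioFn G y (p i) (algConn G) = ratioFn G w₁ (p i) (algConn G) → y = w₁) →
      (∀ y, IsPendantOf G p j y →
        ratioFn G y (p j) (algConn G) = ratioFn G w₂ (p j) (algConn G) → y = w₂) →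
      (∀ s, s ≠ w₁ → x s < x w₁) ∧ (∀ s, s ≠ w₂ → x w₂ < x s)) := by
  have ha := algConn_pos hG.connected
  obtain ⟨hanti, hneg⟩ := hB.strictAnti hG hp hx hi hj hpos
  obtain ⟨m1, m2, m3⟩ := hB.maximum hG hp ha hx.laplace_apply hpos hneg
    (fun l hl => hanti (Fin.lt_def.2 (by have := Fin.val_ne_of_ne hl; omega))) hw₁ hg₁ h₁
  obtain ⟨n1, n2, n3⟩ := hB.maximum (x := -x) (i := j) (j := i) hG hp ha
    (laplace_neg_eq hx.laplace_apply) (by simpa using hneg) (by simpa using hpos)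
    (fun l hl => by
      have h : x (p j) < x (p l) := hanti (Fin.lt_def.2 (by
        have := Fin.val_ne_of_ne hl; have := l.2; omega))
      simpa using h) hw₂ hg₂ h₂
  simp only [Pi.neg_apply, neg_le_neg_iff, neg_lt_neg_iff, neg_pos] at n1 n2 n3
  exact ⟨⟨n2, m2, fun s => ⟨n1 s, m1 s⟩⟩, fun u₁ u₂ => ⟨m3 u₁, n3 u₂⟩⟩

theorem hasFED_iff (hG : G.Connected) (hs : AlgConnSimple G)
    (h : ∀ x, IsFiedlerVector G x → OnlyExtrema x w₁ w₂) :
    HasFED G ↔ EndsOfLongestPath G w₁ w₂ := by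
  refine ⟨?_, fun he => ⟨hs, w₁, w₂, he, h⟩⟩
  rintro ⟨-, y, z, he, hyz⟩
  obtain ⟨x, hx⟩ := exists_isFiedlerVector hG
  rcases onlyExtrema_or (hyz x hx) (h x hx) with ⟨rfl, rfl⟩ | ⟨rfl, rfl⟩
  · exact he
  · intro s t
    rw [SimpleGraph.dist_comm (u := z)]
    exact he s t

/-- Simplicity of `a(G)` and the extrema of the Fiedler vectors under the branch condition. -/
theorem fiedler_extrema (hG : G.IsTree) (hk : 1 ≤ k) (hp : IsVertexPath G p)
    (hC : BranchCondition G p) :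
    AlgConnSimple G ∧
      ∀ (first last : Fin k) (w₁ w₂ : V), 3 ≤ k → (first : ℕ) = 0 → (last : ℕ) + 1 = k →
        IsPendantOf G p first w₁ → IsPendantOf G p last w₂ →
        0 < ratioFn G w₁ (p first) (algConn G) →
        0 < ratioFn G w₂ (p last) (algConn G) →
        (∀ (i : Fin k) (y : V), i ≠ last → IsPendantOf G p i y →
          ratioFn G w₁ (p first) (algConn G) ≤ ratioFn G y (p i) (algConn G)) →
        (∀ (i : Fin k) (y : V), i ≠ first → IsPendantOf G p i y →
          ratioFn G w₂ (p last) (algConn G) ≤ ratioFn G y (p i) (algConn G)) →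
        (∀ x : V → ℝ, IsFiedlerVector G x →
          (x w₂ < 0 ∧ 0 < x w₁ ∧ ∀ s, x w₂ ≤ x s ∧ x s ≤ x w₁) ∨
          (x w₁ < 0 ∧ 0 < x w₂ ∧ ∀ s, x w₁ ≤ x s ∧ x s ≤ x w₂)) ∧
        ((∀ y : V, IsPendantOf G p first y →
            ratioFn G y (p first) (algConn G) = ratioFn G w₁ (p first) (algConn G) → y = w₁) →
          (∀ y : V, IsPendantOf G p last y →
            ratioFn G y (p last) (algConn G) = ratioFn G w₂ (p last) (algConn G) → y = w₂) →
          (∀ x : V → ℝ, IsFiedlerVector G x → OnlyExtrema x w₁ w₂) ∧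
          (HasFED G ↔ EndsOfLongestPath G w₁ w₂)) ∧
        ((∀ y : V, IsPendantOf G p first y → y = w₁) →
          (∀ y : V, IsPendantOf G p last y → y = w₂) → HasFED G) := by
  have hB : PosBranches G p (algConn G) := fun i y hy hyi => hC.posOn hG hp hy hyi
  have hs := hB.algConnSimple hG hp hk
  refine ⟨hs, ?_⟩
  intro first last w₁ w₂ hk3 hf hl hw₁ hw₂ hg₁ hg₂ h₁ h₂
  have hne : ∀ x, IsFiedlerVector G x → x (p first) ≠ 0 := fun x hx h =>
    hx.2 (hB.eq_zero_of_first hG hp hx.laplace_apply hf h)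
  have hext := fun x hx hpos => ratioFn_extrema hG hp hB hf hl hw₁ hw₂ hg₁ hg₂ h₁ h₂
    (x := x) hx hpos
  have honly : (∀ y : V, IsPendantOf G p first y →
      ratioFn G y (p first) (algConn G) = ratioFn G w₁ (p first) (algConn G) → y = w₁) →
      (∀ y : V, IsPendantOf G p last y →
      ratioFn G y (p last) (algConn G) = ratioFn G w₂ (p last) (algConn G) → y = w₂) →
      ∀ x : V → ℝ, IsFiedlerVector G x → OnlyExtrema x w₁ w₂ := by
    intro u₁ u₂ x hx
    rcases (hne x hx).lt_or_gt with h | h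
    · obtain ⟨a, b⟩ := (hext (-x) hx.neg (by simpa using h)).2 u₁ u₂
      simp only [Pi.neg_apply, neg_lt_neg_iff] at a b
      exact Or.inr ⟨b, a⟩
    · exact Or.inl ((hext x hx h).2 u₁ u₂)
  refine ⟨fun x hx => ?_, fun u₁ u₂ => ⟨honly u₁ u₂, hasFED_iff hG.connected hs (honly u₁ u₂)⟩,
    fun u₁ u₂ => ?_⟩
  · rcases (hne x hx).lt_or_gt with h | h
    · obtain ⟨a, b, c⟩ := (hext (-x) hx.neg (by simpa using h)).1
      simp only [Pi.neg_apply, neg_le_neg_iff, neg_lt_zero, neg_pos] at a b c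
      exact Or.inr ⟨b, a, fun s => (c s).symm⟩
    · exact Or.inl (hext x hx h).1
  · exact (hasFED_iff hG.connected hs (honly (fun y hy _ => u₁ y hy) fun y hy _ => u₂ y hy)).2
      (hB.endsOfLongestPath hG hp (algConn_pos hG.connected) hf hl (by omega) hw₁ hw₂ h₁ h₂ u₁ u₂)

end FED

/-! ### The slope of the ratio function at `0` -/

section Slope
open Filter Topology
open scoped Classical
variable {V : Type*} {G : SimpleGraph V} {c w : V}

theorem attached_leaf_eq {m : ℕ} {q : Fin (m + 1) → V} (hG : G.IsTree) (hq : IsVertexPath G q)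
    (hm : 0 < m) (hleaf : (G.neighborSet (q 0)).ncard = 1) : attached G q 0 = {q 0} := by
  refine Set.Subset.antisymm (fun y hy => ?_) (Set.singleton_subset_iff.2 (self_mem_attached hq 0))
  by_contra hne
  obtain ⟨u, hu, hadj, -⟩ := exists_adj_of_mem_attached hG hq hy hne
  have hadj' : G.Adj (q 0) (q ⟨1, by omega⟩) := hq.2 0 ⟨1, by omega⟩ (by simp)
  obtain ⟨n, hn⟩ := Set.ncard_eq_one.1 hleaf
  have h1 : u = n := by rw [← Set.mem_singleton_iff, ← hn]; exact hadj
  have h2 : q ⟨1, by omega⟩ = n := by rw [← Set.mem_singleton_iff, ← hn]; exact hadj'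
  rw [h1, ← h2] at hu
  have := eq_of_path_mem_attached hG.isAcyclic hq hu
  simp [Fin.ext_iff] at this

/-- As the tree attached to a leaf `q 0` is a single vertex, the first summand of the slope is the
term of index `0` of the weighted sum of the sizes of all attached trees. -/
theorem pathSlope_eq {m : ℕ} {q : Fin (m + 1) → V} (hG : G.IsTree) (hq : IsVertexPath G q)
    (hm : 0 < m) (hleaf : (G.neighborSet (q 0)).ncard = 1) :
    (pathSlope G q : ℝ) = -∑ l, ((m : ℝ) - l) * (attached G q l).ncard := by
  rw [pathSlope]
  push_cast
  rw [← Finset.add_sum_erase (s := univ) (f := fun l : Fin (m + 1) =>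
    ((m : ℝ) - l) * ((attached G q l).ncard : ℝ)) (Finset.mem_univ (0 : Fin (m + 1)))]
  rw [← Finset.add_sum_erase (s := univ) (f := fun l : Fin (m + 1) =>
    if 0 < (l : ℕ) then ((m : ℝ) - l) * ((attached G q l).ncard : ℝ) else 0)
    (Finset.mem_univ (0 : Fin (m + 1)))]
  rw [attached_leaf_eq hG hq hm hleaf]
  have h : ∑ l ∈ univ.erase (0 : Fin (m + 1)),
      (if 0 < (l : ℕ) then ((m : ℝ) - l) * ((attached G q l).ncard : ℝ) else 0)
      = ∑ l ∈ univ.erase (0 : Fin (m + 1)), ((m : ℝ) - l) * (attached G q l).ncard := by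
    refine Finset.sum_congr rfl fun l hl => if_pos ?_
    exact Nat.pos_of_ne_zero fun h => (Finset.mem_erase.1 hl).1 (Fin.ext h)
  rw [h]
  simp
  ring

variable [Fintype V]

/-- Solutions of the eigenvalue equation outside `c`, normalized by the value `1` at `c`, exist for
spectral parameters near `0` and tend to the constant `1`. -/
theorem exists_solution_family (hG : G.Connected) (c : V) (D : Set V) (hD : c ∉ D) :
    ∃ ε > 0, ∃ Y : ℝ → V → ℝ, (∀ t, |t| < ε → PosOn G D t ∧ Y t c = 1 ∧
      ∀ z ∈ D, laplace G (Y t) z = t * Y t z) ∧ ∀ z, Tendsto (fun t => Y t z) (𝓝 0) (𝓝 1) := by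
  obtain ⟨ε, hε, hco⟩ := exists_coercive hG c
  have hpos : ∀ t, |t| < ε / 2 → PosOn G D t := fun t ht =>
    (posOn_of_coercive hco (by linarith [le_abs_self t])).mono fun z hz => by
      rintro rfl; exact hD hz
  have hsol : ∀ t, ∃ y : V → ℝ, |t| < ε / 2 →
      (∀ z ∉ D, y z = 1) ∧ ∀ z ∈ D, laplace G y z = t * y z := by
    intro t
    by_cases ht : |t| < ε / 2
    · obtain ⟨y, hy⟩ := (hpos t ht).exists_solution fun _ => 1
      exact ⟨y, fun _ => hy⟩
    · exact ⟨0, fun h => absurd h ht⟩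
  choose Y hY using hsol
  refine ⟨ε / 2, by positivity, Y, fun t ht => ⟨hpos t ht, (hY t ht).1 c hD, (hY t ht).2⟩,
    fun z => ?_⟩
  set n : ℝ := (Fintype.card V : ℝ)
  -- Energy estimate for the difference to the constant `1`.
  have hbound : ∀ t, |t| < ε / 2 → (Y t z - 1) ^ 2 ≤ 4 * n * t ^ 2 / ε ^ 2 := by
    intro t ht
    obtain ⟨h1, h2⟩ := hY t ht
    set f : V → ℝ := fun z => Y t z - 1 with hf
    have hf0 : ∀ z ∉ D, f z = 0 := fun z hz => by simp [hf, h1 z hz]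
    have hL : ∀ z, laplace G f z = laplace G (Y t) z := fun z => by
      simp [laplace_apply, hf]
    have hen := hco f (hf0 c hD)
    have hterm : ∀ z, f z * laplace G f z ≤ 3 * ε / 4 * f z ^ 2 + t ^ 2 / ε := by
      intro z
      by_cases hz : z ∈ D
      · have hYf : Y t z = f z + 1 := by simp [hf]
        rw [hL, h2 z hz, hYf]
        have h3 : t * f z ^ 2 ≤ ε / 2 * f z ^ 2 :=
          mul_le_mul_of_nonneg_right ((le_abs_self t).trans ht.le) (sq_nonneg _)
        have h4 : t * f z ≤ ε / 4 * f z ^ 2 + t ^ 2 / ε := by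
          have : 0 ≤ (ε / 2 * f z - t) ^ 2 / ε := by positivity
          have e : (ε / 2 * f z - t) ^ 2 / ε = ε / 4 * f z ^ 2 - t * f z + t ^ 2 / ε := by
            field_simp; ring
          linarith
        nlinarith
      · rw [hf0 z hz]
        have : 0 ≤ t ^ 2 / ε := by positivity
        nlinarith
    have hsum : ∑ z, f z * laplace G f z ≤ 3 * ε / 4 * ∑ z, f z ^ 2 + n * (t ^ 2 / ε) := by
      refine (Finset.sum_le_sum fun z _ => hterm z).trans_eq ?_
      rw [Finset.sum_add_distrib, ← Finset.mul_sum, Finset.sum_const, nsmul_eq_mul,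
        Finset.card_univ]
    have hz : f z ^ 2 ≤ ∑ z, f z ^ 2 :=
      Finset.single_le_sum (f := fun z => f z ^ 2) (fun _ _ => sq_nonneg _) (Finset.mem_univ z)
    have h5 : ε / 4 * f z ^ 2 ≤ n * (t ^ 2 / ε) := by nlinarith
    calc f z ^ 2 = 4 / ε * (ε / 4 * f z ^ 2) := by field_simp
      _ ≤ 4 / ε * (n * (t ^ 2 / ε)) := mul_le_mul_of_nonneg_left h5 (by positivity)
      _ = 4 * n * t ^ 2 / ε ^ 2 := by field_simp
  have hev : ∀ᶠ t : ℝ in 𝓝 0, |t| < ε / 2 := by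
    have : Tendsto (fun t : ℝ => |t|) (𝓝 0) (𝓝 0) := by
      simpa using (continuous_abs (G := ℝ)).tendsto 0
    exact this.eventually_lt_const (by positivity)
  have hsq : Tendsto (fun t => (Y t z - 1) ^ 2) (𝓝 0) (𝓝 0) := by
    refine tendsto_of_tendsto_of_tendsto_of_le_of_le' tendsto_const_nhds
      (h := fun t : ℝ => 4 * n * t ^ 2 / ε ^ 2) ?_ (Eventually.of_forall fun t => sq_nonneg _)
      (hev.mono hbound)
    have : Continuous fun t : ℝ => 4 * n * t ^ 2 / ε ^ 2 := by fun_prop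
    simpa using this.tendsto 0
  have habs : Tendsto (fun t => |Y t z - 1|) (𝓝 0) (𝓝 0) := by
    have := (Real.continuous_sqrt.tendsto 0).comp hsq
    simpa [Function.comp_def, Real.sqrt_sq_eq_abs] using this
  simpa using (tendsto_zero_iff_abs_tendsto_zero _).2 habs |>.add_const 1

/-- The flow identity summed along a path. -/
theorem path_sub_eq {m : ℕ} {q : Fin (m + 1) → V} (hG : G.IsTree) (hq : IsVertexPath G q)
    {x : V → ℝ} {t : ℝ}
    (hx : ∀ z ∈ comp G (q (Fin.last m)) (q 0), laplace G x z = t * x z) (i : Fin (m + 1)) :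
    x (q 0) - x (q i) =
      t * ∑ l with l ≤ i, ((i : ℝ) - l) * ∑ z with z ∈ attached G q l, x z := by
  obtain ⟨n, hn⟩ : ∃ n, (i : ℕ) = n := ⟨_, rfl⟩
  induction n generalizing i with
  | zero =>
    have hi : i = 0 := Fin.ext hn
    subst hi
    rw [sub_self, Finset.sum_eq_zero, mul_zero]
    intro l hl
    rw [Fin.le_zero_iff.1 (Finset.mem_filter.1 hl).2]
    simp
  | succ n ih =>
    have hi := i.2
    let j : Fin (m + 1) := ⟨n, by omega⟩
    have hji : (j : ℕ) + 1 = i := by simp only [j]; omega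
    have h1 := ih j rfl
    have h2 := path_step hG hq hji fun z hz => hx z (comp_path_subset hG hq hji hz)
    have hcast : (i : ℝ) = (j : ℝ) + 1 := by rw [← hji]; push_cast; ring
    have hset : univ.filter (fun l => l ≤ i) = insert i (univ.filter (fun l => l ≤ j)) := by
      ext l
      simp only [Finset.mem_filter, Finset.mem_univ, true_and, Finset.mem_insert, Fin.le_def,
        Fin.ext_iff]
      omega
    rw [hset, Finset.sum_insert (by
      simp only [Finset.mem_filter, Finset.mem_univ, true_and, Fin.le_def]; omega), sub_self,
      zero_mul, zero_add]
    have h3 : ∑ l with l ≤ j, ((i : ℝ) - l) * ∑ z with z ∈ attached G q l, x z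
        = (∑ l with l ≤ j, ((j : ℝ) - l) * ∑ z with z ∈ attached G q l, x z)
          + ∑ l with l ≤ j, ∑ z with z ∈ attached G q l, x z := by
      rw [← Finset.sum_add_distrib]
      refine Finset.sum_congr rfl fun l _ => ?_
      rw [hcast]; ring
    rw [h3, mul_add, ← h1, ← h2]
    ring

theorem ratioFn_zero (hG : G.IsTree) (hwc : w ≠ c) (hw : (G.neighborSet w).ncard = 1) :
    ratioFn G w c 0 = 1 := by
  obtain ⟨ε, hε, hco⟩ := exists_coercive hG.connected c
  have hpos : PosOn G (comp G c w) 0 := (posOn_of_coercive hco hε).mono fun z hz =>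
    ne_of_mem_comp hz
  simpa using ratioFn_mul (x := fun _ => 1) hG.connected hwc hw hpos fun z _ => by
    simp [laplace_const]

/-- The derivative at `0` of the ratio function of a leaf. -/
theorem hasDerivAt_ratioFn {m : ℕ} {q : Fin (m + 1) → V} (hG : G.IsTree) (hq : IsVertexPath G q)
    (hm : 0 < m) (h0 : q 0 = w) (hlast : q (Fin.last m) = c)
    (hleaf : (G.neighborSet w).ncard = 1) :
    HasDerivAt (ratioFn G w c) (pathSlope G q : ℝ) 0 := by
  have hwc : w ≠ c := by
    rintro rfl
    have := hq.1 (h0.trans hlast.symm)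
    simp [Fin.ext_iff] at this
    omega
  obtain ⟨ε, hε, Y, hY, hlim⟩ := exists_solution_family hG.connected c (comp G c w) notMem_comp
  rw [pathSlope_eq hG hq hm (h0 ▸ hleaf)]
  let Q : ℝ → ℝ := fun t => ∑ l : Fin (m + 1), ((m : ℝ) - l) * ∑ z with z ∈ attached G q l, Y t z
  have hQ : Tendsto Q (𝓝 0) (𝓝 (∑ l : Fin (m + 1), ((m : ℝ) - l) * (attached G q l).ncard)) := by
    refine tendsto_finsetSum _ fun l _ => Tendsto.const_mul _ ?_
    have h := tendsto_finsetSum (univ.filter (· ∈ attached G q l)) fun z _ => hlim z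
    rwa [Finset.sum_const, nsmul_eq_mul, mul_one, ← Set.ncard_coe_finset,
      Finset.coe_filter_univ] at h
  have hYQ : ∀ t, |t| < ε → Y t w - 1 = t * Q t := by
    intro t ht
    obtain ⟨-, h1, h2⟩ := hY t ht
    have h := path_sub_eq hG hq (x := Y t) (t := t) (by rwa [h0, hlast]) (Fin.last m)
    rw [h0, hlast, h1] at h
    rw [h]
    congr 1
    refine Finset.sum_congr ?_ fun l _ => by simp
    ext l; simp [Fin.le_last]
  have hr : ∀ t, |t| < ε → ratioFn G w c t * Y t w = 1 := by
    intro t ht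
    obtain ⟨h1, h2, h3⟩ := hY t ht
    rw [ratioFn_mul hG.connected hwc hleaf h1 h3, h2]
  rw [hasDerivAt_iff_tendsto_slope_zero, ← div_one (∑ l : Fin (m + 1), _), ← neg_div]
  have hlim' := ((hQ.neg).div (hlim w) one_ne_zero).mono_left
    (nhdsWithin_le_nhds (s := {0}ᶜ))
  refine hlim'.congr' ?_
  have hev : ∀ᶠ t : ℝ in 𝓝[≠] 0, |t| < ε := by
    have : Tendsto (fun t : ℝ => |t|) (𝓝 0) (𝓝 0) := by
      simpa using (continuous_abs (G := ℝ)).tendsto 0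
    exact (this.eventually_lt_const hε).filter_mono nhdsWithin_le_nhds
  filter_upwards [hev, self_mem_nhdsWithin] with t ht ht0
  have ht0' : t ≠ 0 := ht0
  have hYne : Y t w ≠ 0 := right_ne_zero_of_mul (by rw [hr t ht]; exact one_ne_zero)
  have h1 : ratioFn G w c t = 1 / Y t w := eq_div_of_mul_eq hYne (hr t ht)
  have h2 := hYQ t ht
  simp only [Pi.div_apply, smul_eq_mul]
  rw [zero_add, ratioFn_zero hG hwc hleaf, h1]
  field_simp
  linarith

end Slope

/-! ### Algebraic connectivity of trees with a long path -/

section Bound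
open scoped Classical

theorem sum_sq_sub_ge (C : ℝ) (N : ℕ) :
    (N : ℝ) * (N ^ 2 - 1) / 12 ≤ ∑ i ∈ Finset.range N, (C - i) ^ 2 := by
  have h : ∑ i ∈ Finset.range N, (C - i) ^ 2
      = N * (C - (N - 1) / 2) ^ 2 + (N : ℝ) * (N ^ 2 - 1) / 12 := by
    induction N with
    | zero => simp
    | succ N ih => rw [Finset.sum_range_succ, ih]; push_cast; ring
  rw [h]
  have : 0 ≤ (N : ℝ) * (C - (N - 1) / 2) ^ 2 := by positivity
  linarith

variable {V : Type*} [Fintype V] {G : SimpleGraph V}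

/-- The algebraic connectivity of a tree is small if the tree contains a long path; the test
function is the position of the projection to the path. -/
theorem algConn_mul_le_of_path (hG : G.IsTree) {k : ℕ} (hk : 2 ≤ k) {p : Fin k → V}
    (hp : IsVertexPath G p) : algConn G * k ≤ 12 := by
  obtain ⟨n, rfl⟩ : ∃ n, k = n + 1 := ⟨k - 1, by omega⟩
  have : Nontrivial V := ⟨p ⟨0, by omega⟩, p ⟨1, by omega⟩, fun h => by
    have := hp.1 h; simp [Fin.ext_iff] at this⟩
  have ha := algConn_pos hG.connected
  let A : Fin n → Set V := fun a => comp G (p a.succ) (p a.castSucc)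
  let g : V → ℝ := fun z => ∑ a : Fin n, if z ∈ A a then 1 else 0
  have hadj : ∀ a : Fin n, G.Adj (p a.succ) (p a.castSucc) := fun a =>
    (hp.2 a.castSucc a.succ (by simp)).symm
  have hgp : ∀ i : Fin (n + 1), g (p i) = n - i := by
    intro i
    have hmem : ∀ a : Fin n, p i ∈ A a ↔ i ≤ a.castSucc := by
      intro a
      rw [show A a = comp G (p a.succ) (p a.castSucc) from rfl,
        mem_comp_path_iff hG hp (i := a.castSucc) (j := a.succ) (by simp)]
      constructor
      · rintro ⟨l, hl, hil⟩
        rw [eq_of_path_mem_attached hG.isAcyclic hp hil]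
        exact hl
      · exact fun h => ⟨i, h, self_mem_attached hp i⟩
    simp only [g, hmem]
    have h1 : ∀ a : Fin n, (i ≤ a.castSucc) ↔ (i : ℕ) ≤ (a : ℕ) := fun a => by
      rw [Fin.le_def, Fin.val_castSucc]
    simp only [h1]
    rw [Fin.sum_univ_eq_sum_range (fun a => if (i : ℕ) ≤ a then (1 : ℝ) else 0) n,
      ← Finset.sum_filter, Finset.sum_const, nsmul_eq_mul, mul_one]
    have hset : (Finset.range n).filter (fun a => (i : ℕ) ≤ a) = Finset.Ico (i : ℕ) n := by
      ext a; simp; omega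
    rw [hset, Nat.card_Ico, Nat.cast_sub (by have := i.2; omega)]
  -- `g` counts the path edges between a vertex and the end of the path; subtract its mean.
  set μ : ℝ := (∑ z, g z) / Fintype.card V with hμ
  let f : V → ℝ := fun z => g z - μ
  have hcard : (Fintype.card V : ℝ) ≠ 0 := by
    have := Fintype.card_pos (α := V)
    positivity
  have hf0 : ∑ z, f z = 0 := by
    simp only [f, Finset.sum_sub_distrib, Finset.sum_const, nsmul_eq_mul, Finset.card_univ, hμ]
    field_simp
    ring
  have henergy : ∑ z, f z * laplace G f z = n := by
    have h1 : ∑ z, f z * laplace G f z = ∑ z, g z * laplace G f z := by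
      simp only [f, sub_mul, Finset.sum_sub_distrib, ← Finset.mul_sum]
      rw [sum_laplace]; ring
    have h2 : ∑ z, g z * laplace G f z = ∑ a : Fin n, ∑ z with z ∈ A a, laplace G f z := by
      simp only [g, Finset.sum_mul]
      rw [Finset.sum_comm]
      refine Finset.sum_congr rfl fun a _ => ?_
      rw [Finset.sum_filter]
      exact Finset.sum_congr rfl fun z _ => by split_ifs <;> simp
    rw [h1, h2, Finset.sum_congr rfl fun a _ => sum_comp_laplace hG (hadj a) f]
    simp [f, hgp]
  have hsq : ((n : ℝ) + 1) * (((n : ℝ) + 1) ^ 2 - 1) / 12 ≤ ∑ z, f z ^ 2 := by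
    have h1 := sum_sq_sub_ge (n - μ) (n + 1)
    push_cast at h1
    refine h1.trans ?_
    rw [← Fin.sum_univ_eq_sum_range (fun a => ((n : ℝ) - μ - a) ^ 2) (n + 1)]
    calc ∑ i : Fin (n + 1), ((n : ℝ) - μ - (i : ℕ)) ^ 2 = ∑ i : Fin (n + 1), f (p i) ^ 2 :=
          Finset.sum_congr rfl fun i _ => by simp only [f, hgp]; ring
      _ = ∑ z ∈ univ.map ⟨p, hp.1⟩, f z ^ 2 := by rw [Finset.sum_map]; rfl
      _ ≤ ∑ z, f z ^ 2 :=
          Finset.sum_le_sum_of_subset_of_nonneg (Finset.subset_univ _) fun _ _ _ => sq_nonneg _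
  have hray := algConn_mul_le hG.connected hf0
  rw [henergy] at hray
  have h3 := (mul_le_mul_of_nonneg_left hsq ha.le).trans hray
  have hn : (0 : ℝ) < n := by
    have : 0 < n := by omega
    positivity
  have h4 : algConn G * (n + 1) * ((n : ℝ) + 2) ≤ 12 := by
    refine le_of_mul_le_mul_right ?_ hn
    calc algConn G * (n + 1) * ((n : ℝ) + 2) * n
        = 12 * (algConn G * (((n : ℝ) + 1) * (((n : ℝ) + 1) ^ 2 - 1) / 12)) := by ring
      _ ≤ 12 * n := mul_le_mul_of_nonneg_left h3 (by norm_num)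
  push_cast
  have h5 : 0 < algConn G * ((n : ℝ) + 1) := by positivity
  nlinarith

end Bound

/-! ### Comparison of two leaves of a fixed attached tree -/

section Transfer
open scoped Classical
variable {V : Type*} [Fintype V] {T : SimpleGraph V} {B : Type*} [Fintype B] {S : SimpleGraph B}

/-- The eigenvalue equation at the vertices of an attached tree, other than its root, involves only
that tree. -/
theorem laplace_transfer (hT : T.IsAcyclic) {k : ℕ} {p : Fin k → V} (hp : IsVertexPath T p)
    {i : Fin k} (φ : S ≃g T.induce (attached T p i)) (x : V → ℝ) {b : B} (hb : (φ b : V) ≠ p i) :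
    laplace S (fun b => x (φ b)) b = laplace T x (φ b) := by
  rw [laplace_apply, laplace_apply]
  have h1 := Equiv.sum_comp φ.toEquiv fun u : attached T p i =>
    if T.Adj (φ b) u then x (φ b) - x u else 0
  have h2 := sum_set_coe (attached T p i) fun u => if T.Adj (φ b) u then x (φ b) - x u else 0
  calc _ = _ := Finset.sum_congr rfl fun b' _ => ?_
    _ = _ := h1
    _ = _ := h2
    _ = _ := Finset.sum_congr rfl fun u _ => ?_
  · have : S.Adj b b' ↔ T.Adj (φ b) (φ b') := φ.map_rel_iff.symm
    simp only [this]
    rfl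
  · by_cases hu : T.Adj (φ b) u
    · rw [if_pos (mem_attached_of_adj_of_ne hT hp (φ b).2 hb hu)]
    · simp [hu]

end Transfer

section Comparison
open Filter Topology
open scoped Classical
variable {B : Type*} {S : SimpleGraph B} {r c w w' : B}

/-- A leaf lies in the interior of no path. -/
theorem eq_of_leaf_separates (hS : S.IsTree) (hr : w ≠ r) (hw : (S.neighborSet w).ncard = 1)
    (h : ∀ q : S.Walk w' r, w ∈ q.support) : w' = w := by
  by_contra hne
  obtain ⟨n, hn, hrn⟩ := exists_adj_mem_comp hS.connected hr.symm
  obtain ⟨n', hn', hwn⟩ := exists_adj_mem_comp hS.connected hne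
  obtain ⟨a, ha⟩ := Set.ncard_eq_one.1 hw
  have h1 : n = a := by rw [← Set.mem_singleton_iff, ← ha]; exact hn
  have h2 : n' = a := by rw [← Set.mem_singleton_iff, ← ha]; exact hn'
  rw [h2, ← h1] at hwn
  obtain ⟨q, hq⟩ := mem_comp_trans hwn (mem_comp_symm hrn)
  exact hq (h q)

theorem pathSlope_of_eq {m : ℕ} {q : Fin (m + 1) → B} (hm : m = 0) : pathSlope S q = 0 := by
  subst hm
  simp [pathSlope]

variable [Fintype B]

/-- The value at a leaf and at the cut vertex of an eigenvector on a rooted tree. -/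
theorem ratioFn_mul_of_separates (hS : S.IsTree) (hwc : w ≠ c)
    (hw : (S.neighborSet w).ncard = 1) (h : ∀ q : S.Walk w r, c ∈ q.support) {t : ℝ}
    (hpos : PosOn S {r}ᶜ t) {y : B → ℝ} (hy : ∀ b, b ≠ r → laplace S y b = t * y b) :
    ratioFn S w c t * y w = y c := by
  have hr : r ∉ comp S c w := fun hr => by
    obtain ⟨q, hq⟩ := mem_comp_symm hr
    exact hq (h q)
  have hne : ∀ z ∈ comp S c w, z ≠ r := by
    rintro z hz rfl; exact hr hz
  exact ratioFn_mul hS.connected hwc hw (hpos.mono hne) fun z hz => hy z (hne z hz)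

/-- A solution on a rooted tree that does not vanish at the root vanishes nowhere. -/
theorem ne_zero_of_root (hS : S.IsTree) {t : ℝ} (hpos : PosOn S {r}ᶜ t) {y : B → ℝ}
    (hy : ∀ b, b ≠ r → laplace S y b = t * y b) (hr : y r ≠ 0) (b : B) : y b ≠ 0 := by
  by_cases hb : b = r
  · rwa [hb]
  have hP : PosOn S (comp S r b) t := hpos.mono fun z hz => ne_of_mem_comp hz
  have hmem := self_mem_comp (G := S) hb
  rcases hr.lt_or_gt with h | h
  · have := hP.pos (x := -y) hS.connected (fun z hz => by
      rw [map_neg, Pi.neg_apply, hy z (ne_of_mem_comp hz), Pi.neg_apply]; ring)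
      (by simpa using h) hmem
    simp only [Pi.neg_apply, neg_pos] at this
    exact this.ne
  · exact (hP.pos hS.connected (fun z hz => hy z (ne_of_mem_comp hz)) h hmem).ne'

/-- Of two functions that agree at `0`, the one with the larger derivative dominates to the right.
-/
theorem eventually_lt_of_hasDerivAt {f g : ℝ → ℝ} {f' g' : ℝ} (hf : HasDerivAt f f' 0)
    (hg : HasDerivAt g g' 0) (h0 : f 0 = g 0) (h : g' < f') : ∀ᶠ t in 𝓝[>] 0, g t < f t := by
  have hd := (hasDerivAt_iff_tendsto_slope_zero.1 (hf.sub hg)).mono_left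
    (nhdsWithin_mono 0 fun t (ht : (0 : ℝ) < t) => ht.ne')
  filter_upwards [hd.eventually_const_lt (sub_pos.2 h), self_mem_nhdsWithin] with t h1 ht
  have ht' : (0 : ℝ) < t := ht
  simp only [zero_add, Pi.sub_apply, h0, sub_self, sub_zero, smul_eq_mul] at h1
  have := (pos_iff_pos_of_mul_pos h1).1 (inv_pos.2 ht')
  linarith

/-- The slopes of the two ratio functions, and the resulting comparison of the values of a Fiedler
vector at two leaves of an attached tree, when the path is long. -/
theorem longPath_comparison.{a, b} (B : Type b) [Fintype B] (S : SimpleGraph B) (hS : S.IsTree)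
    (r c w w' : B)
    (hwr : w ≠ r) (hw : (S.neighborSet w).ncard = 1)
    (hwr' : w' ≠ r) (hw' : (S.neighborSet w').ncard = 1)
    (hc : ∀ q : S.Walk w r, c ∈ q.support) (hc' : ∀ q : S.Walk w' r, c ∈ q.support)
    (m m' : ℕ) (q : Fin (m + 1) → B) (q' : Fin (m' + 1) → B)
    (hq : IsVertexPath S q) (hq0 : q 0 = w) (hqc : q (Fin.last m) = c)
    (hq' : IsVertexPath S q') (hq0' : q' 0 = w') (hqc' : q' (Fin.last m') = c)
    (hslope : pathSlope S q > pathSlope S q') :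
    HasDerivAt (ratioFn S w c) (pathSlope S q : ℝ) 0 ∧
    HasDerivAt (ratioFn S w' c) (pathSlope S q' : ℝ) 0 ∧
    ∃ K : ℕ, ∀ (V : Type a) [Fintype V] (T : SimpleGraph V) (_ : T.IsTree)
        (k : ℕ) (_ : K ≤ k) (p : Fin k → V) (_ : IsVertexPath T p) (i : Fin k)
        (φ : S ≃g T.induce (attached T p i)) (_ : (φ r : V) = p i)
        (x : V → ℝ) (_ : IsFiedlerVector T x),
        (x (p i) ≠ 0 → x (φ w) ≠ 0 ∧ x (φ w') / x (φ w) ≥ 1) ∧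
        (x (p i) = 0 → x (φ w) = 0 ∧ x (φ w') = 0) := by
  -- If one of the leaves is `c`, so is the other, and both slopes vanish.
  have hne : w ≠ c ∧ w' ≠ c := by
    have hzero : ¬ (w = c ∧ w' = c) := by
      rintro ⟨h1, h2⟩
      have e1 := hq.1 (hq0.trans (h1.trans hqc.symm))
      have e2 := hq'.1 (hq0'.trans (h2.trans hqc'.symm))
      simp only [Fin.ext_iff, Fin.val_zero, Fin.val_last] at e1 e2
      rw [pathSlope_of_eq e1.symm, pathSlope_of_eq e2.symm] at hslope
      exact lt_irrefl _ hslope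
    refine ⟨fun h => hzero ⟨h, ?_⟩, fun h => hzero ⟨?_, h⟩⟩
    · subst h
      exact eq_of_leaf_separates hS hwr hw hc'
    · subst h
      exact eq_of_leaf_separates hS hwr' hw' hc
  have hm : 0 < m := Nat.pos_of_ne_zero fun h => hne.1 (by subst h; exact hq0.symm.trans hqc)
  have hm' : 0 < m' := Nat.pos_of_ne_zero fun h => hne.2 (by subst h; exact hq0'.symm.trans hqc')
  have hd := hasDerivAt_ratioFn hS hq hm hq0 hqc hw
  have hd' := hasDerivAt_ratioFn hS hq' hm' hq0' hqc' hw'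
  refine ⟨hd, hd', ?_⟩
  have h0 := ratioFn_zero hS hne.1 hw
  have h0' := ratioFn_zero hS hne.2 hw'
  obtain ⟨ε, hε, hco⟩ := exists_coercive hS.connected r
  have hev : ∀ᶠ t in 𝓝[>] (0 : ℝ), ratioFn S w' c t < ratioFn S w c t ∧ 0 < ratioFn S w' c t :=
    (eventually_lt_of_hasDerivAt hd hd' (h0.trans h0'.symm) (by exact_mod_cast hslope)).and
      ((hd'.continuousAt.tendsto.eventually_const_lt (h0' ▸ one_pos)).filter_mono
        nhdsWithin_le_nhds)
  obtain ⟨η, hη, hηt⟩ := (mem_nhdsGT_iff_exists_Ioo_subset).1 hev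
  have hη0 : (0 : ℝ) < η := hη
  obtain ⟨K, hK⟩ := exists_nat_gt (12 / min ε η)
  refine ⟨max K 2, ?_⟩
  intro V _ T hT k hk p hp i φ hφ x hx
  have hk2 : 2 ≤ k := (le_max_right _ _).trans hk
  have : Nontrivial V := ⟨p ⟨0, by omega⟩, p ⟨1, by omega⟩, fun h => by
    have := hp.1 h; simp [Fin.ext_iff] at this⟩
  have ha := algConn_pos hT.connected
  have hmin : algConn T < min ε η := by
    have h1 := algConn_mul_le_of_path hT hk2 hp
    have h2 : (K : ℝ) ≤ k := by exact_mod_cast (le_max_left _ _).trans hk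
    have h3 : 0 < min ε η := lt_min hε hη0
    rw [div_lt_iff₀ h3] at hK
    have h4 : (0 : ℝ) < k := by positivity
    by_contra h
    rw [not_lt] at h
    have := mul_le_mul_of_nonneg_right h h4.le
    nlinarith
  have hpos : PosOn S {r}ᶜ (algConn T) :=
    posOn_of_coercive hco (hmin.trans_le (min_le_left _ _))
  obtain ⟨hlt, hg'⟩ := hηt ⟨ha, hmin.trans_le (min_le_right _ _)⟩
  have hy : ∀ b, b ≠ r → laplace S (fun b => x (φ b)) b = algConn T * x (φ b) := by
    intro b hb
    have : (φ b : V) ≠ p i := by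
      rw [← hφ]
      exact fun h => hb (φ.injective (Subtype.ext h))
    rw [laplace_transfer hT.isAcyclic hp φ x this, hx.laplace_apply]
  have e := ratioFn_mul_of_separates hS hne.1 hw hc hpos (y := fun b => x (φ b)) hy
  have e' := ratioFn_mul_of_separates hS hne.2 hw' hc' hpos (y := fun b => x (φ b)) hy
  refine ⟨fun hxi => ?_, fun hxi => ?_⟩
  · have hnz := ne_zero_of_root hS hpos (y := fun b => x (φ b)) hy (by simpa only [hφ] using hxi)
    refine ⟨hnz w, ?_⟩
    have hratio : x (φ w') / x (φ w) = ratioFn S w c (algConn T) / ratioFn S w' c (algConn T) := by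
      rw [div_eq_div_iff (hnz w) hg'.ne']
      linarith
    rw [hratio, ge_iff_le, one_le_div hg']
    exact hlt.le
  · have hz : (fun b => x (φ b)) = 0 := hpos.eq_zero (fun b hb => by
      have hbr : b = r := by simpa using hb
      subst hbr
      simpa only [hφ] using hxi) fun b hb => hy b hb
    exact ⟨congrFun hz w, congrFun hz w'⟩

end Comparison

end GenCaterpillar

theorem theorem5p3 :
    -- parts (a) and (b)
    (∀ (V : Type u) [Fintype V] [Nontrivial V] (T : SimpleGraph V) (_ : T.IsTree)
        (k : ℕ) (_ : 1 ≤ k) (p : Fin k → V) (_ : GenCaterpillar.IsVertexPath T p)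
        (_ : GenCaterpillar.BranchCondition T p),
      GenCaterpillar.AlgConnSimple T ∧
      ∀ (first last : Fin k) (w₁ w₂ : V), 3 ≤ k → (first : ℕ) = 0 → (last : ℕ) + 1 = k →
        GenCaterpillar.IsPendantOf T p first w₁ → GenCaterpillar.IsPendantOf T p last w₂ →
        0 < GenCaterpillar.ratioFn T w₁ (p first) (GenCaterpillar.algConn T) →
        0 < GenCaterpillar.ratioFn T w₂ (p last) (GenCaterpillar.algConn T) →
        (∀ (i : Fin k) (y : V), i ≠ last → GenCaterpillar.IsPendantOf T p i y →
          GenCaterpillar.ratioFn T w₁ (p first) (GenCaterpillar.algConn T)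
            ≤ GenCaterpillar.ratioFn T y (p i) (GenCaterpillar.algConn T)) →
        (∀ (i : Fin k) (y : V), i ≠ first → GenCaterpillar.IsPendantOf T p i y →
          GenCaterpillar.ratioFn T w₂ (p last) (GenCaterpillar.algConn T)
            ≤ GenCaterpillar.ratioFn T y (p i) (GenCaterpillar.algConn T)) →
        -- opposite signs and extremality
        (∀ x : V → ℝ, GenCaterpillar.IsFiedlerVector T x →
          (x w₂ < 0 ∧ 0 < x w₁ ∧ ∀ s, x w₂ ≤ x s ∧ x s ≤ x w₁) ∨
          (x w₁ < 0 ∧ 0 < x w₂ ∧ ∀ s, x w₁ ≤ x s ∧ x s ≤ x w₂)) ∧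
        -- unique minimizers: only two extrema, hence (FED) if they are the ends of a longest path
        ((∀ y : V, GenCaterpillar.IsPendantOf T p first y →
            GenCaterpillar.ratioFn T y (p first) (GenCaterpillar.algConn T)
              = GenCaterpillar.ratioFn T w₁ (p first) (GenCaterpillar.algConn T) → y = w₁) →
          (∀ y : V, GenCaterpillar.IsPendantOf T p last y →
            GenCaterpillar.ratioFn T y (p last) (GenCaterpillar.algConn T)
              = GenCaterpillar.ratioFn T w₂ (p last) (GenCaterpillar.algConn T) → y = w₂) →
          (∀ x : V → ℝ, GenCaterpillar.IsFiedlerVector T x →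
            GenCaterpillar.OnlyExtrema x w₁ w₂) ∧
          (GenCaterpillar.HasFED T ↔ GenCaterpillar.EndsOfLongestPath T w₁ w₂)) ∧
        -- unique pendant vertices in the two end trees: (FED)
        ((∀ y : V, GenCaterpillar.IsPendantOf T p first y → y = w₁) →
          (∀ y : V, GenCaterpillar.IsPendantOf T p last y → y = w₂) →
          GenCaterpillar.HasFED T)) ∧
    -- part (c)
    (∀ (B : Type v) [Fintype B] (S : SimpleGraph B) (_ : S.IsTree) (r c w w' : B)
        (_ : w ≠ r) (_ : (S.neighborSet w).ncard = 1)
        (_ : w' ≠ r) (_ : (S.neighborSet w').ncard = 1)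
        (_ : ∀ q : S.Walk w r, c ∈ q.support) (_ : ∀ q : S.Walk w' r, c ∈ q.support)
        (m m' : ℕ) (q : Fin (m + 1) → B) (q' : Fin (m' + 1) → B)
        (_ : GenCaterpillar.IsVertexPath S q) (_ : q 0 = w) (_ : q (Fin.last m) = c)
        (_ : GenCaterpillar.IsVertexPath S q') (_ : q' 0 = w') (_ : q' (Fin.last m') = c)
        (_ : ∀ i j, q i = q' j → q i = c)
        (_ : GenCaterpillar.pathSlope S q > GenCaterpillar.pathSlope S q'),
      HasDerivAt (GenCaterpillar.ratioFn S w c) (GenCaterpillar.pathSlope S q : ℝ) 0 ∧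
      HasDerivAt (GenCaterpillar.ratioFn S w' c) (GenCaterpillar.pathSlope S q' : ℝ) 0 ∧
      ∃ K : ℕ, ∀ (V : Type u) [Fintype V] (T : SimpleGraph V) (_ : T.IsTree)
        (k : ℕ) (_ : K ≤ k) (p : Fin k → V) (_ : GenCaterpillar.IsVertexPath T p) (i : Fin k)
        (φ : S ≃g T.induce (GenCaterpillar.attached T p i)) (_ : (φ r : V) = p i)
        (x : V → ℝ) (_ : GenCaterpillar.IsFiedlerVector T x),
        (x (p i) ≠ 0 → x (φ w) ≠ 0 ∧ x (φ w') / x (φ w) ≥ 1) ∧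
        (x (p i) = 0 → x (φ w) = 0 ∧ x (φ w') = 0)) := by
  refine ⟨?_, ?_⟩
  · intro V _ _ T hT k hk p hp hC
    exact GenCaterpillar.fiedler_extrema hT hk hp hC
  · intro B _ S hS r c w w' hwr hw hwr' hw' hc hc' m m' q q' hq hq0 hqc hq' hq0' hqc' _ hslope
    exact GenCaterpillar.longPath_comparison B S hS r c w w' hwr hw hwr' hw' hc hc' m m' q q'
      hq hq0 hqc hq' hq0' hqc' hslope
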